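/- Let $\mathbb N=\{1,2,\dots\}$ and let $s$ be the space of rapidly decreasing sequences, that is, of all $\xi\in\mathbb C^{\mathbb N}$ with $|\xi|_q:=\bigl(\sum_j|\xi_j|^2j^{2q}\bigr)^{1/2}<\infty$ for every $q\in\mathbb N_0$. With the topology of the norms $|\cdot|_q$, pointwise multiplication and complex conjugation, $s$ is a Fréchet ${}^*$-algebra. Let $s'$ be its dual, identified with the space of all sequences $\eta$ with $|\eta|'_q:=\bigl(\sum_j|\eta_j|^2j^{-2q}\bigr)^{1/2}<\infty$ for some $q\in\mathbb N_0$, with the locally convex inductive limit topology, and put $\langle\xi,\eta\rangle=\sum_j\xi_j\overline{\eta_j}$. Let $\mathcal L(s',s)$ be the space of continuous linear maps $s'\to s$ with the topology of uniform convergence on bounded subsets of $s'$. It is a ${}^*$-algebra with the product $xy=x\circ j\circ y$, where $j\colon s\hookrightarrow s'$ is the inclusion, and with the involution $x\mapsto x^*$ given by the hermitian adjoint on $\ell_2$. For $k\in\mathbb N$ let $m_k$ be the $k$-th prime number, $N_{k,1}:=m_k$ and $N_{k,j+1}:=m_k^{N_{k,j}}$ for $j\in\mathbb N$, and let $$a_{k,j}:=c_k\,\frac{\prod_{i=1}^{j-1}N_{k,i}}{N_{k,j}^{\,j-1}},\qquad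 c_k:=\Bigl(\sum_{j=1}^\infty\Bigl(\frac{\prod_{i=1}^{j-1}N_{k,i}}{N_{k,j}^{\,j-1}}\Bigr)^2\Bigr)^{-1/2}.$$ **Theorem.** For every $k\in\mathbb N$ the series $f_k:=\sum_{j=1}^\infty a_{k,j}e_{N_{k,j}}$ converges in $s$ (where $e_n$ is the $n$-th unit sequence), and $(f_k)_{k\in\mathbb N}$ is orthonormal in $\ell_2$. The closed ${}^*$-subalgebra $E$ of $\mathcal L(s',s)$ generated by the operators $\langle\cdot,f_k\rangle f_k$, $k\in\mathbb N$, is commutative, and it is not isomorphic to any closed ${}^*$-subalgebra $F$ of $s$: there is no Fréchet ${}^*$-algebra isomorphism (a linear, multiplicative, ${}^*$-preserving homeomorphism) from $E$ onto $F$, and not even an isomorphism of complex algebras (a linear multiplicative bijection). In particular, there is a closed commutative ${}^*$-subalgebra of $\mathcal L(s',s)$ that is not isomorphic to any closed ${}^*$-subalgebra of $s$. -/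

import Mathlib

namespace SmoothOp

open scoped ComplexConjugate

noncomputable section

/-! ### Weighted `ℓ₂`-norms of sequences indexed by `{1, 2, 3, …}` -/

/-- `∑_j |ξ_j|² j^{2q} < ∞`, for an integer `q`. -/
def WSum (q : ℤ) (ξ : ℕ+ → ℂ) : Prop :=
  Summable fun j : ℕ+ => ‖ξ j‖ ^ 2 * (j : ℝ) ^ (2 * q)

/-- `(∑_j |ξ_j|² j^{2q})^{1/2}`, for an integer `q` (used only where `WSum q ξ` holds). -/
def wnorm (q : ℤ) (ξ : ℕ+ → ℂ) : ℝ :=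
  √(∑' j : ℕ+, ‖ξ j‖ ^ 2 * (j : ℝ) ^ (2 * q))

/-- The pairing `⟨ξ, η⟩ = ∑_j ξ_j \overline{η_j}`. -/
def pair (ξ η : ℕ+ → ℂ) : ℂ := ∑' j : ℕ+, ξ j * conj (η j)

theorem pnat_pos (j : ℕ+) : (0 : ℝ) < (j : ℝ) := by exact_mod_cast j.pos

theorem one_le_pnat (j : ℕ+) : (1 : ℝ) ≤ (j : ℝ) := by exact_mod_cast PNat.pos j

theorem wterm_eq (q : ℤ) (ξ : ℕ+ → ℂ) (j : ℕ+) :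
    ‖ξ j‖ ^ 2 * (j : ℝ) ^ (2 * q) = (‖ξ j‖ * (j : ℝ) ^ q) ^ 2 := by
  rw [mul_pow, ← zpow_natCast ((j : ℝ) ^ q) 2, ← zpow_mul, mul_comm q]; norm_num

theorem wterm_nonneg (q : ℤ) (ξ : ℕ+ → ℂ) (j : ℕ+) :
    0 ≤ ‖ξ j‖ ^ 2 * (j : ℝ) ^ (2 * q) := by rw [wterm_eq]; positivity

theorem wnorm_nonneg (q : ℤ) (ξ : ℕ+ → ℂ) : 0 ≤ wnorm q ξ := Real.sqrt_nonneg _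

theorem wsum_zero (q : ℤ) : WSum q 0 := by
  simp [WSum]

theorem wnorm_zero (q : ℤ) : wnorm q 0 = 0 := by simp [wnorm]

theorem WSum.smul {q : ℤ} {ξ : ℕ+ → ℂ} (h : WSum q ξ) (c : ℂ) : WSum q (c • ξ) := by
  have := Summable.mul_left (‖c‖ ^ 2) h
  refine this.congr fun j => ?_
  simp only [Pi.smul_apply, smul_eq_mul, norm_mul]; ring

theorem wnorm_smul (q : ℤ) (c : ℂ) (ξ : ℕ+ → ℂ) : wnorm q (c • ξ) = ‖c‖ * wnorm q ξ := by
  have : ∀ j : ℕ+, ‖(c • ξ) j‖ ^ 2 * (j : ℝ) ^ (2 * q)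
      = ‖c‖ ^ 2 * (‖ξ j‖ ^ 2 * (j : ℝ) ^ (2 * q)) := fun j => by
    simp only [Pi.smul_apply, smul_eq_mul, norm_mul]; ring
  rw [wnorm, tsum_congr this, tsum_mul_left, Real.sqrt_mul (by positivity),
    Real.sqrt_sq (norm_nonneg _), wnorm]

theorem WSum.add_aux {q : ℤ} {ξ η : ℕ+ → ℂ} (h : WSum q ξ) (h' : WSum q η) :
    WSum q (ξ + η) ∧ wnorm q (ξ + η) ≤ wnorm q ξ + wnorm q η := by
  have hf : Summable fun j : ℕ+ => (‖ξ j‖ * (j : ℝ) ^ q) ^ (2 : ℝ) := by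
    refine Summable.congr h fun j => ?_
    rw [wterm_eq]; norm_cast
  have hg : Summable fun j : ℕ+ => (‖η j‖ * (j : ℝ) ^ q) ^ (2 : ℝ) := by
    refine Summable.congr h' fun j => ?_
    rw [wterm_eq]; norm_cast
  obtain ⟨h1, h2⟩ := Real.Lp_add_le_tsum_of_nonneg (p := 2) (by norm_num)
    (fun j => by positivity) (fun j => by positivity) hf hg
  have hle : ∀ j : ℕ+, ‖(ξ + η) j‖ ^ 2 * (j : ℝ) ^ (2 * q)
      ≤ (‖ξ j‖ * (j : ℝ) ^ q + ‖η j‖ * (j : ℝ) ^ q) ^ (2 : ℝ) := fun j => by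
    rw [wterm_eq, Real.rpow_two, ← add_mul]
    have := norm_add_le (ξ j) (η j)
    simp only [Pi.add_apply]
    gcongr
  have hs : WSum q (ξ + η) := Summable.of_nonneg_of_le (wterm_nonneg q _) hle h1
  refine ⟨hs, ?_⟩
  simp only [← Real.sqrt_eq_rpow] at h2
  refine le_trans (Real.sqrt_le_sqrt (Summable.tsum_le_tsum hle hs h1)) (h2.trans (le_of_eq ?_))
  simp only [wnorm, wterm_eq, Real.rpow_two]

theorem WSum.add {q : ℤ} {ξ η : ℕ+ → ℂ} (h : WSum q ξ) (h' : WSum q η) : WSum q (ξ + η) :=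
  (h.add_aux h').1

theorem wnorm_add_le {q : ℤ} {ξ η : ℕ+ → ℂ} (h : WSum q ξ) (h' : WSum q η) :
    wnorm q (ξ + η) ≤ wnorm q ξ + wnorm q η := (h.add_aux h').2

theorem wterm_mono {q r : ℤ} (hqr : q ≤ r) (ξ : ℕ+ → ℂ) (j : ℕ+) :
    ‖ξ j‖ ^ 2 * (j : ℝ) ^ (2 * q) ≤ ‖ξ j‖ ^ 2 * (j : ℝ) ^ (2 * r) := by
  gcongr
  exact one_le_pnat j

theorem WSum.mono {q r : ℤ} (hqr : q ≤ r) {ξ : ℕ+ → ℂ} (h : WSum r ξ) : WSum q ξ :=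
  Summable.of_nonneg_of_le (wterm_nonneg q _) (wterm_mono hqr ξ) h

theorem WSum.norm_le {q : ℤ} {ξ : ℕ+ → ℂ} (h : WSum q ξ) (j : ℕ+) :
    ‖ξ j‖ * (j : ℝ) ^ q ≤ wnorm q ξ := by
  apply Real.le_sqrt_of_sq_le
  rw [← wterm_eq]
  exact Summable.le_tsum h j fun i _ => wterm_nonneg q ξ i

theorem WSum.mul {q : ℤ} {ξ η : ℕ+ → ℂ} (h : WSum q ξ) (h' : WSum 0 η) : WSum q (ξ * η) := by
  refine Summable.of_nonneg_of_le (wterm_nonneg q _) (fun j => ?_)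
    (Summable.mul_left (wnorm 0 η ^ 2) h)
  have := h'.norm_le j
  rw [zpow_zero, mul_one] at this
  simp only [Pi.mul_apply, norm_mul, mul_pow]
  have h1 : ‖η j‖ ^ 2 ≤ wnorm 0 η ^ 2 := by gcongr
  have h2 := wterm_nonneg q ξ j
  nlinarith

theorem wterm_star (q : ℤ) (ξ : ℕ+ → ℂ) (j : ℕ+) :
    ‖(star ξ) j‖ ^ 2 * (j : ℝ) ^ (2 * q) = ‖ξ j‖ ^ 2 * (j : ℝ) ^ (2 * q) := by
  simp

theorem WSum.star {q : ℤ} {ξ : ℕ+ → ℂ} (h : WSum q ξ) : WSum q (star ξ) :=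
  Summable.congr h fun j => (wterm_star q ξ j).symm

/-- The Cauchy–Schwarz inequality for the pairing. -/
theorem pair_bound {q r : ℤ} (hqr : q + r = 0) {ξ η : ℕ+ → ℂ} (h : WSum q ξ) (h' : WSum r η) :
    (Summable fun j : ℕ+ => ξ j * conj (η j)) ∧ ‖pair ξ η‖ ≤ wnorm q ξ * wnorm r η := by
  have hf : Summable fun j : ℕ+ => (‖ξ j‖ * (j : ℝ) ^ q) ^ (2 : ℝ) := by
    refine Summable.congr h fun j => ?_
    rw [wterm_eq]; norm_cast
  have hg : Summable fun j : ℕ+ => (‖η j‖ * (j : ℝ) ^ r) ^ (2 : ℝ) := by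
    refine Summable.congr h' fun j => ?_
    rw [wterm_eq]; norm_cast
  obtain ⟨h1, h2⟩ := Real.summable_and_inner_le_Lp_mul_Lq_tsum_of_nonneg
    (Real.holderConjugate_iff.2 ⟨by norm_num, by norm_num⟩ : Real.HolderConjugate 2 2)
    (fun j => by positivity) (fun j => by positivity) hf hg
  have heq : ∀ j : ℕ+, ‖ξ j‖ * (j : ℝ) ^ q * (‖η j‖ * (j : ℝ) ^ r) = ‖ξ j * conj (η j)‖ := by
    intro j
    have : (j : ℝ) ^ q * (j : ℝ) ^ r = 1 := by
      rw [← zpow_add₀ (pnat_pos j).ne', hqr, zpow_zero]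
    rw [norm_mul, RCLike.norm_conj]
    linear_combination ‖ξ j‖ * ‖η j‖ * this
  simp only [heq] at h1 h2
  refine ⟨h1.of_norm, (norm_tsum_le_tsum_norm h1).trans (h2.trans (le_of_eq ?_))⟩
  simp only [wnorm, wterm_eq, Real.rpow_two, ← Real.sqrt_eq_rpow]

theorem pair_conj (ξ η : ℕ+ → ℂ) : conj (pair ξ η) = pair η ξ := by
  rw [pair, Complex.conj_tsum, pair]
  refine tsum_congr fun j => ?_
  rw [map_mul, Complex.conj_conj, mul_comm]

/-! ### The Fréchet `*`-algebra `s` of rapidly decreasing sequences -/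

/-- Rapidly decreasing sequences, with pointwise operations and conjugation. -/
def rapidSubalgebra : NonUnitalStarSubalgebra ℂ (ℕ+ → ℂ) where
  carrier := {ξ | ∀ q : ℕ, WSum q ξ}
  add_mem' h h' q := (h q).add (h' q)
  zero_mem' q := wsum_zero q
  mul_mem' h h' q := (h q).mul (by simpa using h' 0)
  smul_mem' c _ h q := (h q).smul c
  star_mem' h q := (h q).star

/-- The space `s`. It is a type of its own so that it does not inherit the product topology. -/
def RapidSeq : Type := rapidSubalgebra

instance : NonUnitalCommRing RapidSeq := inferInstanceAs (NonUnitalCommRing rapidSubalgebra)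

instance : StarRing RapidSeq := inferInstanceAs (StarRing rapidSubalgebra)

instance : Module ℂ RapidSeq := inferInstanceAs (Module ℂ rapidSubalgebra)

instance : IsScalarTower ℂ RapidSeq RapidSeq :=
  inferInstanceAs (IsScalarTower ℂ rapidSubalgebra rapidSubalgebra)

instance : SMulCommClass ℂ RapidSeq RapidSeq :=
  inferInstanceAs (SMulCommClass ℂ rapidSubalgebra rapidSubalgebra)

instance : StarModule ℂ RapidSeq := inferInstanceAs (StarModule ℂ rapidSubalgebra)

instance : FunLike RapidSeq ℕ+ ℂ where
  coe ξ := Subtype.val (p := (· ∈ rapidSubalgebra)) ξ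
  coe_injective := Subtype.val_injective

namespace RapidSeq

theorem ext {ξ η : RapidSeq} (h : ∀ j, ξ j = η j) : ξ = η := DFunLike.ext _ _ h

theorem wsum (ξ : RapidSeq) (q : ℕ) : WSum q ξ := ξ.2 q

theorem wsum_neg (ξ : RapidSeq) (q : ℕ) : WSum (-(q : ℤ)) ξ := (ξ.2 0).mono (by simp)

theorem coe_add (ξ η : RapidSeq) : ⇑(ξ + η) = ⇑ξ + ⇑η := rfl

theorem coe_smul (c : ℂ) (ξ : RapidSeq) : ⇑(c • ξ) = c • ⇑ξ := rfl

theorem coe_mul (ξ η : RapidSeq) : ⇑(ξ * η) = ⇑ξ * ⇑η := rfl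

theorem coe_star (ξ : RapidSeq) : ⇑(star ξ) = star ⇑ξ := rfl

/-- The norms `|ξ|_q = (∑_j |ξ_j|² j^{2q})^{1/2}`, `q = 0, 1, 2, …`. -/
def norms : SeminormFamily ℂ RapidSeq ℕ := fun q =>
  Seminorm.of (fun ξ => wnorm q ξ) (fun ξ η => wnorm_add_le (ξ.wsum q) (η.wsum q))
    (fun c ξ => wnorm_smul q c ξ)

/-- The topology of `s` is given by the norms `|·|_q`. -/
instance : TopologicalSpace RapidSeq := norms.moduleFilterBasis.topology

theorem withSeminorms : WithSeminorms norms := ⟨rfl⟩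

instance : IsTopologicalAddGroup RapidSeq := withSeminorms.topologicalAddGroup

instance : ContinuousSMul ℂ RapidSeq := withSeminorms.continuousSMul

end RapidSeq

theorem wsum_single (q : ℤ) (j : ℕ+) : WSum q (Pi.single j 1) := by
  refine summable_of_ne_finset_zero (s := {j}) fun i hi => ?_
  have : i ≠ j := by simpa using hi
  simp [this]

theorem wnorm_single (q : ℤ) (j : ℕ+) : wnorm q (Pi.single j 1) = (j : ℝ) ^ q := by
  rw [wnorm, tsum_eq_single j fun i hi => by simp [hi], wterm_eq]
  simp only [Pi.single_eq_same, norm_one, one_mul]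
  exact Real.sqrt_sq (zpow_nonneg (pnat_pos j).le q)

/-- The unit sequence `e_j ∈ s`. -/
def RapidSeq.unit (j : ℕ+) : RapidSeq := ⟨Pi.single j 1, fun q => wsum_single q j⟩

/-! ### The space `s'` of slowly increasing sequences -/

/-- Slowly increasing sequences. -/
def slowSubmodule : Submodule ℂ (ℕ+ → ℂ) where
  carrier := {η | ∃ q : ℕ, WSum (-(q : ℤ)) η}
  add_mem' := by
    rintro ξ η ⟨q, hq⟩ ⟨r, hr⟩
    refine ⟨max q r, (hq.mono ?_).add (hr.mono ?_)⟩ <;> simp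
  zero_mem' := ⟨0, wsum_zero _⟩
  smul_mem' := by
    rintro c ξ ⟨q, hq⟩
    exact ⟨q, hq.smul c⟩

/-- The space `s'`; its functionals on `s` are `ξ ↦ ⟨ξ, η⟩`. -/
def SlowSeq : Type := slowSubmodule

instance : AddCommGroup SlowSeq := inferInstanceAs (AddCommGroup slowSubmodule)

instance : Module ℂ SlowSeq := inferInstanceAs (Module ℂ slowSubmodule)

instance : FunLike SlowSeq ℕ+ ℂ where
  coe η := Subtype.val (p := (· ∈ slowSubmodule)) η
  coe_injective := Subtype.val_injective

namespace SlowSeq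

theorem ext {ξ η : SlowSeq} (h : ∀ j, ξ j = η j) : ξ = η := DFunLike.ext _ _ h

theorem exists_wsum (η : SlowSeq) : ∃ q : ℕ, WSum (-(q : ℤ)) η := η.2

theorem coe_add (ξ η : SlowSeq) : ⇑(ξ + η) = ⇑ξ + ⇑η := rfl

theorem coe_smul (c : ℂ) (ξ : SlowSeq) : ⇑(c • ξ) = c • ⇑ξ := rfl

/-- The seminorms on `s'` whose restriction to every step
`{η : |η|'_q = (∑_j |η_j|² j^{-2q})^{1/2} < ∞}` is continuous for the norm `|·|'_q`. -/
def IsStepBounded (p : Seminorm ℂ SlowSeq) : Prop :=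
  ∀ q : ℕ, ∃ C : ℝ, ∀ η : SlowSeq, WSum (-(q : ℤ)) η → p η ≤ C * wnorm (-(q : ℤ)) η

def stepSeminorms : SeminormFamily ℂ SlowSeq {p : Seminorm ℂ SlowSeq // IsStepBounded p} :=
  fun p => p.1

instance : Nonempty {p : Seminorm ℂ SlowSeq // IsStepBounded p} :=
  ⟨⟨0, fun _ => ⟨0, fun η _ => by simp⟩⟩⟩

/-- The (locally convex) inductive limit topology of the steps: the finest locally convex
topology for which the inclusions of all steps are continuous. -/
instance : TopologicalSpace SlowSeq := stepSeminorms.moduleFilterBasis.topology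

theorem withSeminorms : WithSeminorms stepSeminorms := ⟨rfl⟩

instance : IsTopologicalAddGroup SlowSeq := withSeminorms.topologicalAddGroup

instance : ContinuousSMul ℂ SlowSeq := withSeminorms.continuousSMul

/-- The unit sequence as an element of `s'`. -/
def unit (j : ℕ+) : SlowSeq := ⟨Pi.single j 1, 0, wsum_single _ j⟩

theorem IsStepBounded.of_le {p p' : Seminorm ℂ SlowSeq} (h : IsStepBounded p) (hle : p' ≤ p) :
    IsStepBounded p' := fun q => by
  obtain ⟨C, hC⟩ := h q
  exact ⟨C, fun η hη => (hle η).trans (hC η hη)⟩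

theorem isStepBounded_of_continuous {p : Seminorm ℂ SlowSeq} (hp : Continuous p) :
    IsStepBounded p := by
  obtain ⟨s, C, -, hC⟩ := Seminorm.bound_of_continuous withSeminorms p hp
  refine IsStepBounded.of_le ?_ hC
  clear hC
  have hs : IsStepBounded (s.sup stepSeminorms) := by
    classical
    induction s using Finset.induction_on with
    | empty => exact fun _ => ⟨0, fun η _ => by simp⟩
    | insert a s _ ih =>
      intro q
      obtain ⟨C₁, h₁⟩ := a.2 q
      obtain ⟨C₂, h₂⟩ := ih q
      refine ⟨max C₁ C₂, fun η hη => ?_⟩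
      rw [Finset.sup_insert, Seminorm.sup_apply]
      have := wnorm_nonneg (-(q : ℤ)) η
      refine max_le ((h₁ η hη).trans ?_) ((h₂ η hη).trans ?_)
      · gcongr; exact le_max_left _ _
      · gcongr; exact le_max_right _ _
  intro q
  obtain ⟨C', h'⟩ := hs q
  refine ⟨C * C', fun η hη => ?_⟩
  rw [_root_.smul_apply, NNReal.smul_def, smul_eq_mul, mul_assoc]
  gcongr
  exact h' η hη

end SlowSeq

/-! ### The algebra `L(s', s)` -/

/-- `L(s', s)`: the continuous linear maps from `s'` to `s`. Mathlib equips it with the topology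
of uniform convergence on bounded subsets of `s'`. -/
abbrev Op : Type := SlowSeq →L[ℂ] RapidSeq

theorem Op.bound (x : Op) (q r : ℕ) :
    ∃ C : ℝ, ∀ η : SlowSeq, WSum (-(r : ℤ)) η → wnorm q (x η) ≤ C * wnorm (-(r : ℤ)) η :=
  SlowSeq.isStepBounded_of_continuous
    (p := (RapidSeq.norms q).comp (x : SlowSeq →ₗ[ℂ] RapidSeq))
    ((RapidSeq.withSeminorms.continuous_seminorm q).comp x.continuous) r

/-- A linear map that is bounded from every step of `s'` to `s` is continuous. -/
def Op.mk (x : SlowSeq →ₗ[ℂ] RapidSeq)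
    (hx : ∀ q r : ℕ, ∃ C : ℝ, ∀ η : SlowSeq, WSum (-(r : ℤ)) η →
      wnorm q (x η) ≤ C * wnorm (-(r : ℤ)) η) : Op where
  toLinearMap := x
  cont := WithSeminorms.continuous_of_continuous_comp RapidSeq.withSeminorms x fun q =>
    SlowSeq.withSeminorms.continuous_seminorm ⟨(RapidSeq.norms q).comp x, hx q⟩

/-- The embedding `j : s → s'`. -/
def incl : RapidSeq →L[ℂ] SlowSeq where
  toFun ξ := ⟨ξ, 0, ξ.wsum_neg 0⟩
  map_add' _ _ := rfl
  map_smul' _ _ := rfl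
  cont := by
    let j : RapidSeq →ₗ[ℂ] SlowSeq :=
      { toFun := fun ξ => ⟨ξ, 0, ξ.wsum_neg 0⟩, map_add' := fun _ _ => rfl,
        map_smul' := fun _ _ => rfl }
    refine WithSeminorms.continuous_of_continuous_comp SlowSeq.withSeminorms j fun p => ?_
    obtain ⟨C, hC⟩ := p.2 0
    refine Seminorm.continuous_of_le (q := (Real.toNNReal C) • RapidSeq.norms 0)
      ((RapidSeq.withSeminorms.continuous_seminorm 0).const_smul _) fun ξ => ?_
    refine (hC (j ξ) (ξ.wsum_neg 0)).trans ?_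
    rw [_root_.smul_apply, NNReal.smul_def, smul_eq_mul]
    have : wnorm (-((0 : ℕ) : ℤ)) (j ξ) = RapidSeq.norms 0 ξ := by
      simp only [Nat.cast_zero, neg_zero]; rfl
    rw [this]
    gcongr
    exact Real.le_coe_toNNReal C

/-- The multiplication `xy = x ∘ j ∘ y`. -/
instance : Mul Op := ⟨fun x y => x.comp (incl.comp y)⟩

theorem Op.mul_apply (x y : Op) (η : SlowSeq) : (x * y) η = x (incl (y η)) := rfl

instance : NonUnitalRing Op where
  left_distrib x y z := by ext1 η; simp [Op.mul_apply]
  right_distrib x y z := by ext1 η; simp [Op.mul_apply]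
  zero_mul x := by ext1 η; simp [Op.mul_apply]
  mul_zero x := by ext1 η; simp [Op.mul_apply]
  mul_assoc x y z := rfl

instance : IsScalarTower ℂ Op Op := ⟨fun c x y => by ext1 η; simp [Op.mul_apply]⟩

instance : SMulCommClass ℂ Op Op := ⟨fun c x y => by ext1 η; simp [Op.mul_apply]⟩

/-- A pairing of `s'` with a fixed element of `s` is given by an absolutely convergent series. -/
theorem summable_pair (η : SlowSeq) (ξ : RapidSeq) : Summable fun j => η j * conj (ξ j) := by
  obtain ⟨q, hq⟩ := η.exists_wsum
  exact (pair_bound (by simp) hq (ξ.wsum q)).1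

theorem pair_bound_slow {q : ℕ} {η : SlowSeq} (hη : WSum (-(q : ℤ)) η) (ξ : RapidSeq) :
    ‖pair η ξ‖ ≤ wnorm (-(q : ℤ)) η * wnorm q ξ :=
  (pair_bound (by simp) hη (ξ.wsum q)).2

theorem pair_add (η η' : SlowSeq) (ξ : RapidSeq) :
    pair ⇑(η + η') ξ = pair η ξ + pair η' ξ := by
  rw [pair, pair, pair, ← (summable_pair η ξ).tsum_add (summable_pair η' ξ)]
  exact tsum_congr fun j => by simp [SlowSeq.coe_add, add_mul]

theorem pair_smul (c : ℂ) (η : SlowSeq) (ξ : RapidSeq) :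
    pair ⇑(c • η) ξ = c * pair η ξ := by
  rw [pair, pair, ← tsum_mul_left]
  exact tsum_congr fun j => by simp [SlowSeq.coe_smul, mul_assoc]

/-- The functional `⟨·, ξ⟩` on `s'`. -/
def pairL (ξ : RapidSeq) : SlowSeq →ₗ[ℂ] ℂ where
  toFun η := pair η ξ
  map_add' η η' := pair_add η η' ξ
  map_smul' c η := pair_smul c η ξ

/-- The operator `⟨·, f⟩ g`. -/
def rankOne (f g : RapidSeq) : Op :=
  Op.mk ((pairL f).smulRight g) fun q r => ⟨wnorm r f * wnorm q g, fun η hη => by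
    have h1 : wnorm q ⇑(((pairL f).smulRight g) η) = ‖pair η f‖ * wnorm q g :=
      wnorm_smul q (pair η f) g
    rw [h1]
    have := mul_le_mul_of_nonneg_right (pair_bound_slow hη f) (wnorm_nonneg q g)
    linarith⟩

theorem rankOne_apply (f g : RapidSeq) (η : SlowSeq) : rankOne f g η = pair η f • g := rfl

/-! ### The involution of `L(s', s)` -/

theorem adjoint_aux (x : Op) (q r : ℕ) : ∃ C : ℝ, ∀ η : SlowSeq, WSum (-(r : ℤ)) η →
    WSum q (fun j => pair η (x (SlowSeq.unit j))) ∧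
    wnorm q (fun j => pair η (x (SlowSeq.unit j))) ≤ C * wnorm (-(r : ℤ)) η := by
  obtain ⟨C, hC⟩ := x.bound r (q + 1)
  have hS : Summable fun j : ℕ+ => ((j : ℝ) ^ 2)⁻¹ := by
    have := (Real.summable_nat_pow_inv (p := 2)).2 (by norm_num)
    exact this.comp_injective PNat.coe_injective
  have key : ∀ η : SlowSeq, WSum (-(r : ℤ)) η → ∀ j : ℕ+,
      ‖pair η (x (SlowSeq.unit j))‖ ^ 2 * (j : ℝ) ^ (2 * (q : ℤ))
        ≤ (C * wnorm (-(r : ℤ)) η) ^ 2 * ((j : ℝ) ^ 2)⁻¹ := by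
    intro η hη j
    have h1 := pair_bound_slow hη (x (SlowSeq.unit j))
    have h2 := hC (SlowSeq.unit j) (wsum_single _ j)
    have h3 : wnorm (-((q + 1 : ℕ) : ℤ)) (SlowSeq.unit j) = (j : ℝ) ^ (-((q + 1 : ℕ) : ℤ)) :=
      wnorm_single _ j
    rw [h3] at h2
    have h4 : ‖pair η (x (SlowSeq.unit j))‖
        ≤ C * wnorm (-(r : ℤ)) η * (j : ℝ) ^ (-((q + 1 : ℕ) : ℤ)) :=
      h1.trans ((mul_le_mul_of_nonneg_left h2 (wnorm_nonneg _ _)).trans (le_of_eq (by ring)))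
    have hj := pnat_pos j
    have h5 : ‖pair η (x (SlowSeq.unit j))‖ * (j : ℝ) ^ (q : ℤ)
        ≤ C * wnorm (-(r : ℤ)) η * (j : ℝ)⁻¹ := by
      refine (mul_le_mul_of_nonneg_right h4 (zpow_nonneg hj.le _)).trans (le_of_eq ?_)
      rw [mul_assoc, ← zpow_add₀ hj.ne', ← zpow_neg_one]
      congr 2
      push_cast; ring
    rw [wterm_eq q (fun j => pair η (x (SlowSeq.unit j))) j, ← inv_pow, ← mul_pow]
    gcongr
  refine ⟨|C| * √(∑' j : ℕ+, ((j : ℝ) ^ 2)⁻¹), fun η hη => ?_⟩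
  have hs : WSum q (fun j => pair η (x (SlowSeq.unit j))) :=
    Summable.of_nonneg_of_le (wterm_nonneg q _) (key η hη) (hS.mul_left _)
  refine ⟨hs, (Real.sqrt_le_sqrt (Summable.tsum_le_tsum (key η hη) hs (hS.mul_left _))).trans
    (le_of_eq ?_)⟩
  rw [tsum_mul_left, Real.sqrt_mul (sq_nonneg _), Real.sqrt_sq_eq_abs, abs_mul,
    abs_of_nonneg (wnorm_nonneg _ _)]
  ring

theorem adjoint_mem (x : Op) (η : SlowSeq) (q : ℕ) :
    WSum q (fun j => pair η (x (SlowSeq.unit j))) := by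
  obtain ⟨r, hr⟩ := η.exists_wsum
  obtain ⟨C, hC⟩ := adjoint_aux x q r
  exact (hC η hr).1

/-- The adjoint `x^*`, with coordinates `(x^* η)_j = ⟨η, x e_j⟩`. It is the hermitian adjoint
of `x` on `ℓ₂`, see `pair_apply`. -/
def Op.adjoint (x : Op) : Op :=
  Op.mk
    { toFun := fun η => ⟨fun j => pair η (x (SlowSeq.unit j)), adjoint_mem x η⟩
      map_add' := fun η η' => RapidSeq.ext fun j => pair_add η η' (x (SlowSeq.unit j))
      map_smul' := fun c η => RapidSeq.ext fun j => pair_smul c η (x (SlowSeq.unit j)) }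
    fun q r => by
      obtain ⟨C, hC⟩ := adjoint_aux x q r
      exact ⟨C, fun η hη => (hC η hη).2⟩

instance : Star Op := ⟨Op.adjoint⟩

theorem Op.star_apply (x : Op) (η : SlowSeq) (j : ℕ+) :
    (star x) η j = pair η (x (SlowSeq.unit j)) := rfl

/-- A linear functional that is bounded on every step of `s'` is given by its values on the
unit sequences. -/
theorem hasSum_functional (φ : SlowSeq →ₗ[ℂ] ℂ)
    (hφ : ∀ r : ℕ, ∃ C : ℝ, ∀ η : SlowSeq, WSum (-(r : ℤ)) η →
      ‖φ η‖ ≤ C * wnorm (-(r : ℤ)) η) (η : SlowSeq) :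
    HasSum (fun j => η j * φ (SlowSeq.unit j)) (φ η) := by
  obtain ⟨r, hr⟩ := η.exists_wsum
  obtain ⟨C, hC⟩ := hφ r
  rw [HasSum, SummationFilter.unconditional_filter]
  rw [tendsto_iff_norm_sub_tendsto_zero]
  have hval : ∀ s : Finset ℕ+, ∀ i : ℕ+, (η - ∑ j ∈ s, η j • SlowSeq.unit j : SlowSeq) i
      = if i ∈ s then 0 else η i := by
    intro s i
    have h1 : (η - ∑ j ∈ s, η j • SlowSeq.unit j : SlowSeq) i
        = η i - (∑ j ∈ s, η j • SlowSeq.unit j : SlowSeq) i := rfl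
    have h2 : (∑ j ∈ s, η j • SlowSeq.unit j : SlowSeq) i
        = ∑ j ∈ s, η j * (Pi.single j 1 : ℕ+ → ℂ) i := by
      have := congrFun (map_sum slowSubmodule.subtype (fun j => (η j • SlowSeq.unit j : SlowSeq)) s)
        i
      rw [Finset.sum_apply] at this
      exact this
    rw [h1, h2]
    by_cases hi : i ∈ s <;> simp [Pi.single_apply, hi]
  have hterm : ∀ s : Finset ℕ+, ∀ i : ℕ+,
      ‖(η - ∑ j ∈ s, η j • SlowSeq.unit j : SlowSeq) i‖ ^ 2 * (i : ℝ) ^ (2 * (-(r : ℤ)))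
      = if i ∈ s then 0 else ‖η i‖ ^ 2 * (i : ℝ) ^ (2 * (-(r : ℤ))) := by
    intro s i
    rw [hval]; split_ifs <;> simp
  have hws : ∀ s : Finset ℕ+, WSum (-(r : ℤ)) (η - ∑ j ∈ s, η j • SlowSeq.unit j : SlowSeq) := by
    intro s
    refine Summable.of_nonneg_of_le (wterm_nonneg _ _) (fun i => ?_) hr
    rw [hterm]; split_ifs
    · exact wterm_nonneg _ _ _
    · exact le_rfl
  have hnorm : Filter.Tendsto
      (fun s : Finset ℕ+ => wnorm (-(r : ℤ)) (η - ∑ j ∈ s, η j • SlowSeq.unit j : SlowSeq))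
      Filter.atTop (nhds 0) := by
    have h0 := tendsto_tsum_compl_atTop_zero
      (fun i : ℕ+ => ‖η i‖ ^ 2 * (i : ℝ) ^ (2 * (-(r : ℤ))))
    have h1 := (Real.continuous_sqrt.tendsto 0).comp h0
    rw [Real.sqrt_zero] at h1
    refine h1.congr fun s => ?_
    simp only [Function.comp_apply, wnorm]
    congr 1
    rw [tsum_congr (hterm s)]
    refine (tsum_subtype {i : ℕ+ | i ∉ s} fun i : ℕ+ =>
      ‖η i‖ ^ 2 * (i : ℝ) ^ (2 * (-(r : ℤ)))).trans ?_
    exact tsum_congr fun i => by by_cases hi : i ∈ s <;> simp [Set.indicator, hi]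
  refine squeeze_zero (fun _ => norm_nonneg _) (fun s => ?_)
    (by simpa using hnorm.const_mul C)
  have : φ η - ∑ j ∈ s, η j * φ (SlowSeq.unit j) = φ (η - ∑ j ∈ s, η j • SlowSeq.unit j) := by
    rw [map_sub, map_sum]; simp
  rw [norm_sub_rev, this]
  exact hC _ (hws s)

/-- `⟨x ξ, η⟩ = ⟨ξ, x^* η⟩`. -/
theorem pair_apply (x : Op) (ξ η : SlowSeq) :
    pair (x ξ) η = pair ξ (star x η) := by
  obtain ⟨t, ht⟩ := η.exists_wsum
  have hp : ∀ ζ : RapidSeq, pair ζ η = conj (pair η ζ) := fun ζ => (pair_conj _ _).symm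
  have hφ := hasSum_functional
    { toFun := fun ζ => pair (x ζ) η
      map_add' := fun ζ ζ' => by
        have h := pair_bound (q := t) (r := -t) (by simp) ((x ζ).wsum t) ht
        have h' := pair_bound (q := t) (r := -t) (by simp) ((x ζ').wsum t) ht
        rw [map_add, pair, pair, pair, ← h.1.tsum_add h'.1]
        exact tsum_congr fun j => by simp [RapidSeq.coe_add, add_mul]
      map_smul' := fun c ζ => by
        rw [map_smul, pair, pair, smul_eq_mul, RingHom.id_apply, ← tsum_mul_left]
        exact tsum_congr fun j => by simp [RapidSeq.coe_smul, mul_assoc] }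
    (fun r => by
      obtain ⟨C, hC⟩ := x.bound t r
      refine ⟨wnorm (-(t : ℤ)) η * C, fun ζ hζ => ?_⟩
      refine (pair_bound (q := t) (r := -t) (by simp) ((x ζ).wsum t) ht).2.trans ?_
      rw [mul_comm, mul_assoc]
      exact mul_le_mul_of_nonneg_left (hC ζ hζ) (wnorm_nonneg _ _)) ξ
  refine hφ.tsum_eq.symm.trans ?_
  rw [pair]
  refine tsum_congr fun j => ?_
  rw [Op.star_apply, pair_conj]
  rfl

theorem pair_single (ξ : ℕ+ → ℂ) (j : ℕ+) : pair ξ (Pi.single j 1) = ξ j := by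
  rw [pair, tsum_eq_single j fun i hi => by simp [hi]]
  simp

theorem Op.ext' {x y : Op} (h : ∀ η j, x η j = y η j) : x = y :=
  ContinuousLinearMap.ext fun η => RapidSeq.ext (h η)

instance : StarRing Op where
  star_involutive x := Op.ext' fun η j => by
    rw [Op.star_apply, ← pair_apply]
    exact pair_single _ j
  star_mul x y := Op.ext' fun η j => by
    rw [Op.star_apply, Op.mul_apply, Op.mul_apply, Op.star_apply, ← pair_conj, pair_apply,
      pair_conj]
    rfl
  star_add x y := Op.ext' fun η j => by
    have h := summable_pair η (x (SlowSeq.unit j))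
    have h' := summable_pair η (y (SlowSeq.unit j))
    have h3 : (star x + star y) η j = star x η j + star y η j := rfl
    rw [h3, Op.star_apply, Op.star_apply, Op.star_apply, pair, pair, pair, ← h.tsum_add h']
    exact tsum_congr fun i => by simp [RapidSeq.coe_add, mul_add]

instance : StarModule ℂ Op where
  star_smul c x := Op.ext' fun η j => by
    have h3 : (star c • star x) η j = star c * star x η j := rfl
    rw [h3, Op.star_apply, Op.star_apply, pair, pair, ← tsum_mul_left]
    refine tsum_congr fun i => ?_
    simp only [_root_.smul_apply, RapidSeq.coe_smul, Pi.smul_apply, smul_eq_mul,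
      map_mul, starRingEnd_apply]
    ring

/-! ### Generated closed subalgebras, isomorphisms, and the vectors of the example -/

/-- `alg(Z)`: the smallest closed `*`-subalgebra of `L(s', s)` that contains `Z`. -/
def alg (Z : Set Op) : NonUnitalStarSubalgebra ℂ Op :=
  sInf {E | IsClosed (E : Set Op) ∧ Z ⊆ E}

/-- Isomorphism as Fréchet `*`-algebras: a bijective linear multiplicative `*`-preserving map,
continuous with its inverse. -/
def IsoFrechetStarAlg (A B : Type*) [NonUnitalRing A] [NonUnitalRing B] [Module ℂ A] [Module ℂ B]
    [Star A] [Star B] [TopologicalSpace A] [TopologicalSpace B] : Prop :=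
  ∃ Φ : A ≃⋆ₐ[ℂ] B, Continuous Φ ∧ Continuous Φ.symm

/-- Isomorphism merely as complex algebras: a bijective linear multiplicative map. -/
def IsoAlg (A B : Type*) [NonUnitalRing A] [NonUnitalRing B] [Module ℂ A] [Module ℂ B] : Prop :=
  ∃ Φ : A ≃ₗ[ℂ] B, ∀ x y, Φ (x * y) = Φ x * Φ y

/-- The towers `N_{k,1} = m_k`, `N_{k,j+1} = m_k ^ N_{k,j}`, with `m_k` the `k`-th prime number.
Here `k` and `j` are counted from `0`. -/
def tower (k : ℕ) : ℕ → ℕ+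
  | 0 => ⟨Nat.nth Nat.Prime k, (Nat.prime_nth_prime k).pos⟩
  | j + 1 => ⟨Nat.nth Nat.Prime k, (Nat.prime_nth_prime k).pos⟩ ^ (tower k j : ℕ)

/-- The unnormalized coefficients `(∏_{i<j} N_{k,i}) / N_{k,j}^{j-1}` (`j` counted from `1`;
here `j` is counted from `0`, so that the exponent is `j`). -/
def rawCoeff (k j : ℕ) : ℝ :=
  (∏ i ∈ Finset.range j, (tower k i : ℝ)) / (tower k j : ℝ) ^ j

/-- The normalized coefficients `a_{k,j} = c_k · rawCoeff k j`, with
`c_k = (∑_j (rawCoeff k j)²)^{-1/2}`. -/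
def coeff (k j : ℕ) : ℝ := (√(∑' i, rawCoeff k i ^ 2))⁻¹ * rawCoeff k j

end

end SmoothOp

open SmoothOp

namespace SmoothOp

open scoped ComplexConjugate
open Filter Topology

/-! ### Absolutely convergent series in `s` -/

/-! The obstruction lies in the growth of the norms |f_k|_q in k. Write P_k for the projection ⟨·,
f_k⟩ f_k and count tower entries from 0. At N_{k,j} the weighted coefficient a_{k,j} N_{k,j}^q is
largest for j = q, so |f_k|_q equals N_{k,0}⋯N_{k,q-1} up to factors depending only on q
(`exists_towerVector`). Since N_{k,p+1} is exponential in N_{k,p}, the norm |f_k|_{p+2} outgrows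
every power of |f_k|_{p+1} as k → ∞ (`eventually_pow_wnorm_le`).

Let Φ be an algebra isomorphism from E onto a closed subalgebra F of s. Each Φ(P_k) is a nonzero
idempotent of s, hence the indicator of a finite set; let d_k be its largest element. An eigenvalue
relation x P_k = c P_k is purely algebraic, so Φ carries it over in both directions.

From E to F: E contains diagonal operators with any sufficiently small eigenvalues, and their images
must decrease rapidly along the d_k. This bounds d_k by a constant times |f_k|_p² for some p and all
large k (`exists_eventually_max_lt`), so every norm of Φ(P_k) is at most polynomial in |f_k|_p.

From F to E: with λ_k = (k+1)/|f_k|_{p+2} the series ∑ λ_k Φ(P_k) therefore converges in s, and its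
sum lies in F because F is closed. Its preimage has eigenvalue λ_k at f_k, but an operator into s
satisfies sup_k |λ_k| |f_k|_{p+2} < ∞ (`eigenvalue_bound`), whereas here this product is k+1.
Neither continuity of Φ nor compatibility with the involution enters. -/

/-- Lower semicontinuity of the weighted norms under pointwise convergence. -/
theorem wsum_and_wnorm_le_of_tendsto {ι : Type*} {l : Filter ι} [l.NeBot] {q : ℤ}
    {g : ι → ℕ+ → ℂ} {ξ : ℕ+ → ℂ} {C : ℝ} (hg : ∀ᶠ t in l, WSum q (g t))
    (hC : ∀ᶠ t in l, wnorm q (g t) ≤ C) (hlim : ∀ j, Tendsto (fun t => g t j) l (𝓝 (ξ j))) :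
    WSum q ξ ∧ wnorm q ξ ≤ C := by
  have hC0 : 0 ≤ C := by
    obtain ⟨t, ht⟩ := hC.exists
    exact (wnorm_nonneg _ _).trans ht
  have hfin : ∀ J : Finset ℕ+, ∑ j ∈ J, ‖ξ j‖ ^ 2 * (j : ℝ) ^ (2 * q) ≤ C ^ 2 := fun J => by
    refine le_of_tendsto (tendsto_finsetSum J fun j _ =>
      ((hlim j).norm.pow 2).mul_const ((j : ℝ) ^ (2 * q))) ?_
    filter_upwards [hg, hC] with t h1 h2
    refine (Summable.sum_le_tsum J (fun j _ => wterm_nonneg q (g t) j) h1).trans ?_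
    rw [← Real.sq_sqrt (tsum_nonneg fun j => wterm_nonneg q (g t) j)]
    exact pow_le_pow_left₀ (Real.sqrt_nonneg _) h2 2
  refine ⟨summable_of_sum_le (wterm_nonneg q ξ) hfin, Real.sqrt_le_iff.2 ⟨hC0, ?_⟩⟩
  exact Real.tsum_le_of_sum_le (wterm_nonneg q ξ) hfin

theorem RapidSeq.norms_apply (q : ℕ) (ξ : RapidSeq) : RapidSeq.norms q ξ = wnorm q ξ := rfl

theorem RapidSeq.norm_mul_pow_le (ξ : RapidSeq) (q : ℕ) (j : ℕ+) :
    ‖ξ j‖ * (j : ℝ) ^ q ≤ wnorm q ξ := by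
  simpa using (ξ.wsum q).norm_le j

theorem RapidSeq.norm_apply_le (ξ : RapidSeq) (q : ℕ) (j : ℕ+) : ‖ξ j‖ ≤ wnorm q ξ :=
  (le_mul_of_one_le_right (norm_nonneg _) (one_le_pow₀ (one_le_pnat j))).trans
    (ξ.norm_mul_pow_le q j)

theorem RapidSeq.sum_apply {ι : Type*} (s : Finset ι) (ξ : ι → RapidSeq) (j : ℕ+) :
    (∑ i ∈ s, ξ i) j = ∑ i ∈ s, ξ i j := by
  classical
  induction s using Finset.induction_on with
  | empty => rfl
  | insert a s ha ih => rw [Finset.sum_insert ha, Finset.sum_insert ha, ← ih]; rfl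

theorem RapidSeq.wnorm_sum_le {ι : Type*} (s : Finset ι) (ξ : ι → RapidSeq) (q : ℕ) :
    wnorm q ⇑(∑ i ∈ s, ξ i) ≤ ∑ i ∈ s, wnorm q (ξ i) := by
  simpa only [RapidSeq.norms_apply] using
    Finset.le_sum_of_subadditive (RapidSeq.norms q) (map_zero _).le (map_add_le_add _) s ξ

theorem RapidSeq.wnorm_mono (ξ : RapidSeq) {q r : ℕ} (h : q ≤ r) : wnorm q ξ ≤ wnorm r ξ :=
  Real.sqrt_le_sqrt (Summable.tsum_le_tsum (wterm_mono (by exact_mod_cast h) ξ)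
    (ξ.wsum q) (ξ.wsum r))

/-- A series in `s` that converges absolutely for all the norms converges, and its sum is
formed coordinatewise. -/
theorem RapidSeq.exists_sum {ι : Type*} (ξ : ι → RapidSeq)
    (h : ∀ q : ℕ, Summable fun i => wnorm q (ξ i)) :
    ∃ η : RapidSeq, (∀ j, HasSum (fun i => ξ i j) (η j)) ∧
      ∀ (q : ℕ) (s : Finset ι),
        wnorm q ⇑(η - ∑ i ∈ s, ξ i) ≤ ∑' i : {i // i ∉ s}, wnorm q (ξ i) := by
  classical
  have hpt : ∀ j, Summable fun i => ξ i j := fun j =>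
    Summable.of_norm_bounded (h 0) fun i => (ξ i).norm_apply_le 0 j
  have hlim : ∀ j, Tendsto (fun s : Finset ι => (∑ i ∈ s, ξ i) j) atTop (𝓝 (∑' i, ξ i j)) :=
    fun j => by
      simp only [RapidSeq.sum_apply]
      exact (hpt j).hasSum
  have hmem : ∀ q : ℕ, WSum q fun j => ∑' i, ξ i j := fun q =>
    (wsum_and_wnorm_le_of_tendsto (l := atTop) (g := fun s : Finset ι => ⇑(∑ i ∈ s, ξ i))
      (Eventually.of_forall fun s => RapidSeq.wsum _ q)
      (Eventually.of_forall fun s => (RapidSeq.wnorm_sum_le s ξ q).trans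
        ((h q).sum_le_tsum s fun i _ => wnorm_nonneg _ _)) hlim).1
  refine ⟨⟨fun j => ∑' i, ξ i j, hmem⟩, fun j => (hpt j).hasSum, fun q s => ?_⟩
  refine (wsum_and_wnorm_le_of_tendsto (l := atTop) (q := q)
    (g := fun t : Finset ι => ⇑(∑ i ∈ t, ξ i - ∑ i ∈ s, ξ i))
    (Eventually.of_forall fun t => RapidSeq.wsum _ q) ?_ fun j => ?_).2
  · filter_upwards [eventually_ge_atTop s] with t ht
    rw [← Finset.sum_sdiff_eq_sub ht]
    refine (RapidSeq.wnorm_sum_le _ ξ q).trans ?_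
    have hs : Summable fun i : {i // i ∉ s} => wnorm q (ξ i) :=
      (h q).comp_injective Subtype.val_injective
    have h1 := hs.sum_le_tsum ((t \ s).subtype (· ∉ s)) fun i _ => wnorm_nonneg _ _
    rwa [Finset.sum_subtype_of_mem (fun i => wnorm q (ξ i))
      (fun i hi => (Finset.mem_sdiff.1 hi).2)] at h1
  · exact (hlim j).sub_const _

theorem RapidSeq.exists_hasSum {ι : Type*} (ξ : ι → RapidSeq)
    (h : ∀ q : ℕ, Summable fun i => wnorm q (ξ i)) :
    ∃ η : RapidSeq, HasSum ξ η ∧ (∀ j, HasSum (fun i => ξ i j) (η j)) ∧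
      ∀ q : ℕ, wnorm q η ≤ ∑' i, wnorm q (ξ i) := by
  obtain ⟨η, h1, h2⟩ := RapidSeq.exists_sum ξ h
  refine ⟨η, ?_, h1, fun q => ?_⟩
  · rw [HasSum, SummationFilter.unconditional_filter, RapidSeq.withSeminorms.tendsto_nhds]
    intro q ε hε
    have := (tendsto_tsum_compl_atTop_zero fun i => wnorm q (ξ i)).eventually_lt_const hε
    filter_upwards [this] with s hs
    rw [map_sub_rev, RapidSeq.norms_apply]
    exact (h2 q s).trans_lt hs
  · have h3 := h2 q ∅
    rw [Finset.sum_empty, sub_zero] at h3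
    exact h3.trans (Summable.tsum_subtype_le _ {i | i ∉ (∅ : Finset ι)}
      (fun i => wnorm_nonneg _ _) (h q))

/-! ### Convergence in `L(s', s)` -/

/-- A family of seminorms on `s'` that is equicontinuous on the steps is uniformly bounded on
bounded sets. -/
theorem SlowSeq.exists_bound_of_isVonNBounded {ι : Type*} [Nonempty ι]
    {p : ι → Seminorm ℂ SlowSeq}
    (hp : ∀ r : ℕ, ∃ C : ℝ, ∀ i, ∀ η : SlowSeq, WSum (-(r : ℤ)) η →
      p i η ≤ C * wnorm (-(r : ℤ)) η)
    {B : Set SlowSeq} (hB : Bornology.IsVonNBounded ℂ B) :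
    ∃ M > 0, ∀ i, ∀ η ∈ B, p i η ≤ M := by
  have hbdd : BddAbove (Set.range p) := by
    refine Seminorm.bddAbove_range_iff.2 fun η => ?_
    obtain ⟨r, hr⟩ := η.exists_wsum
    obtain ⟨C, hC⟩ := hp r
    exact ⟨_, Set.forall_mem_range.2 fun i => hC i η hr⟩
  -- The supremum of the family is again bounded on steps, so it is one of the seminorms defining
  -- the topology of s'. This avoids having to know that a bounded set lies in a single step.
  have hstep : SlowSeq.IsStepBounded (⨆ i, p i) := fun r => by
    obtain ⟨C, hC⟩ := hp r
    refine ⟨C, fun η hη => ?_⟩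
    rw [Seminorm.iSup_apply hbdd]
    exact ciSup_le fun i => hC i η hη
  obtain ⟨M, hM, h⟩ := SlowSeq.withSeminorms.isVonNBounded_iff_seminorm_bounded.1 hB ⟨_, hstep⟩
  refine ⟨M, hM, fun i η hη => le_trans ?_ (h η hη).le⟩
  exact le_ciSup hbdd i η

/-- Convergence in `L(s', s)` with a rate that is uniform on the steps of `s'`. -/
theorem Op.tendsto_of_bound {x : ℕ → Op} {y : Op}
    (h : ∀ q r : ℕ, ∃ C : ℝ, ∀ n : ℕ, ∀ η : SlowSeq, WSum (-(r : ℤ)) η →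
      ((n : ℝ) + 1) * wnorm q ((x n - y) η) ≤ C * wnorm (-(r : ℤ)) η) :
    Tendsto x atTop (𝓝 y) := by
  rw [← tendsto_sub_nhds_zero_iff, ContinuousLinearMap.nhds_zero_eq_of_basis
    RapidSeq.withSeminorms.hasBasis_zero_ball]
  simp only [tendsto_iInf, tendsto_principal]
  rintro B hB ⟨I, ε⟩ hε
  have key : ∀ q : ℕ, ∀ᶠ n in atTop, ∀ η ∈ B, wnorm q ((x n - y) η) < ε := fun q => by
    -- The rate n + 1 is absorbed into the seminorms; one bound M for all of them makes the error at
    -- most M/(n+1) on B.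
    obtain ⟨M, hM, hb⟩ := SlowSeq.exists_bound_of_isVonNBounded
      (p := fun n : ℕ => ((n : NNReal) + 1) •
        (RapidSeq.norms q).comp ((x n - y : Op) : SlowSeq →ₗ[ℂ] RapidSeq)) (h q) hB
    filter_upwards [eventually_gt_atTop ⌈M / ε⌉₊] with n hn η hη
    have h1 : ((n : ℝ) + 1) * wnorm q ((x n - y) η) ≤ M := hb n η hη
    have h2 : M / ε < (n : ℝ) + 1 := (Nat.lt_of_ceil_lt hn).trans (by linarith)
    rw [div_lt_iff₀ hε] at h2
    by_contra hcon
    rw [not_lt] at hcon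
    have : ((n : ℝ) + 1) * ε ≤ ((n : ℝ) + 1) * wnorm q ((x n - y) η) := by gcongr
    linarith
  filter_upwards [(I.eventually_all).2 fun q _ => key q] with n hn η hη
  rw [Seminorm.mem_ball_zero]
  exact Seminorm.finset_sup_apply_lt hε fun q hq => hn q hq η hη

theorem Op.sum_apply {ι : Type*} (s : Finset ι) (x : ι → Op) (η : SlowSeq) :
    (∑ i ∈ s, x i) η = ∑ i ∈ s, x i η := by
  classical
  induction s using Finset.induction_on with
  | empty => rfl
  | insert a s ha ih => rw [Finset.sum_insert ha, Finset.sum_insert ha, ← ih]; rfl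

/-- Series `∑ μ_n ⟨·, f_n⟩ f_n` in `L(s', s)`. -/
theorem Op.exists_tendsto_diagonal (f : ℕ → RapidSeq) (μ : ℕ → ℂ)
    (h : ∀ q : ℕ, Summable fun n : ℕ => ((n : ℝ) + 1) * (‖μ n‖ * wnorm q (f n) ^ 2)) :
    ∃ x : Op,
      Tendsto (fun N => ∑ n ∈ Finset.range N, μ n • rankOne (f n) (f n)) atTop (𝓝 x) ∧
      ∀ (η : SlowSeq) (j : ℕ+), HasSum (fun n => μ n * pair η (f n) * f n j) (x η j) := by
  -- One factor |f_n|_r comes from the pairing with η, one factor |f_n|_q from the vector; the norm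
  -- of index `max q r` dominates both.
  have hterm : ∀ (q r : ℕ) (η : SlowSeq), WSum (-(r : ℤ)) η → ∀ n : ℕ,
      wnorm q ⇑((μ n * pair η (f n)) • f n)
        ≤ ‖μ n‖ * wnorm (max q r : ℕ) (f n) ^ 2 * wnorm (-(r : ℤ)) η := by
    intro q r η hη n
    have e : wnorm q ⇑((μ n * pair η (f n)) • f n) = ‖μ n‖ * ‖pair η (f n)‖ * wnorm q (f n) := by
      rw [RapidSeq.coe_smul, wnorm_smul, norm_mul]
    have h1 := pair_bound_slow hη (f n)
    have h2 := (f n).wnorm_mono (le_max_right q r)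
    have h3 := (f n).wnorm_mono (le_max_left q r)
    have h0 := wnorm_nonneg (-(r : ℤ)) η
    have h4 := wnorm_nonneg (max q r : ℕ) (f n)
    calc wnorm q ⇑((μ n * pair η (f n)) • f n)
        ≤ ‖μ n‖ * (wnorm (-(r : ℤ)) η * wnorm (max q r : ℕ) (f n))
            * wnorm (max q r : ℕ) (f n) := by
          rw [e]
          gcongr
          · exact wnorm_nonneg _ _
          · exact h1.trans (by gcongr)
      _ = _ := by ring
  have hsum : ∀ (η : SlowSeq) (q : ℕ),
      Summable fun n : ℕ => ((n : ℝ) + 1) * wnorm q ⇑((μ n * pair η (f n)) • f n) := by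
    intro η q
    obtain ⟨r, hr⟩ := η.exists_wsum
    refine Summable.of_nonneg_of_le (fun n => mul_nonneg (by positivity) (wnorm_nonneg _ _))
      (fun n => ?_) ((h (max q r)).mul_right (wnorm (-(r : ℤ)) η))
    rw [mul_assoc]
    gcongr
    exact hterm q r η hr n
  have hle : ∀ (η : SlowSeq) (q n : ℕ), wnorm q ⇑((μ n * pair η (f n)) • f n)
      ≤ ((n : ℝ) + 1) * wnorm q ⇑((μ n * pair η (f n)) • f n) := fun η q n =>
    le_mul_of_one_le_left (wnorm_nonneg _ _) (by linarith [n.cast_nonneg (α := ℝ)])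
  choose X hX hXs using fun η : SlowSeq => RapidSeq.exists_sum
    (fun n => (μ n * pair η (f n)) • f n)
    fun q => Summable.of_nonneg_of_le (fun n => wnorm_nonneg _ _) (hle η q) (hsum η q)
  have hX' : ∀ (η : SlowSeq) (j : ℕ+), HasSum (fun n => μ n * pair η (f n) * f n j) (X η j) := hX
  have hbound : ∀ q r : ℕ, ∃ C : ℝ, ∀ N : ℕ, ∀ η : SlowSeq, WSum (-(r : ℤ)) η →
      ((N : ℝ) + 1) * wnorm q
        ⇑(X η - ∑ n ∈ Finset.range N, (μ n * pair η (f n)) • f n) ≤ C * wnorm (-(r : ℤ)) η := by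
    intro q r
    refine ⟨∑' n : ℕ, ((n : ℝ) + 1) * (‖μ n‖ * wnorm (max q r : ℕ) (f n) ^ 2),
      fun N η hη => ?_⟩
    have hs := hsum η q
    calc ((N : ℝ) + 1) * wnorm q
          ⇑(X η - ∑ n ∈ Finset.range N, (μ n * pair η (f n)) • f n)
        ≤ ((N : ℝ) + 1) * ∑' n : {n // n ∉ Finset.range N},
            wnorm q ⇑((μ n * pair η (f n)) • f n) := by
          gcongr
          exact hXs η q _
      _ = ∑' n : {n // n ∉ Finset.range N},
            ((N : ℝ) + 1) * wnorm q ⇑((μ n * pair η (f n)) • f n) := tsum_mul_left.symm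
      -- On the tail n ≥ N, so N + 1 is dominated by the weight n + 1 from the hypothesis. That
      -- weight is what yields a rate of convergence.
      _ ≤ ∑' n : {n // n ∉ Finset.range N},
            ((n : ℕ) + 1 : ℝ) * wnorm q ⇑((μ n * pair η (f n)) • f n) := by
          have hs' : Summable fun n : {n // n ∉ Finset.range N} =>
              ((n : ℕ) + 1 : ℝ) * wnorm q ⇑((μ n * pair η (f n)) • f n) :=
            hs.comp_injective Subtype.val_injective
          have hl : ∀ n : {n // n ∉ Finset.range N},
              ((N : ℝ) + 1) * wnorm q ⇑((μ n * pair η (f n)) • f n)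
              ≤ ((n : ℕ) + 1 : ℝ) * wnorm q ⇑((μ n * pair η (f n)) • f n) := by
            rintro ⟨n, hn⟩
            rw [Finset.mem_range, not_lt] at hn
            have := wnorm_nonneg q ⇑((μ n * pair η (f n)) • f n)
            have hn' : (N : ℝ) ≤ n := by exact_mod_cast hn
            dsimp only
            gcongr
          exact Summable.tsum_le_tsum hl (Summable.of_nonneg_of_le
            (fun n => mul_nonneg (by positivity) (wnorm_nonneg _ _)) hl hs') hs'
      _ ≤ ∑' n : ℕ, ((n : ℝ) + 1) * wnorm q ⇑((μ n * pair η (f n)) • f n) :=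
          Summable.tsum_subtype_le _ {n | n ∉ Finset.range N}
            (fun n => mul_nonneg (by positivity) (wnorm_nonneg _ _)) hs
      _ ≤ ∑' n : ℕ, ((n : ℝ) + 1) * (‖μ n‖ * wnorm (max q r : ℕ) (f n) ^ 2)
            * wnorm (-(r : ℤ)) η := by
          refine Summable.tsum_le_tsum (fun n => ?_) hs ((h (max q r)).mul_right _)
          rw [mul_assoc]
          gcongr
          exact hterm q r η hη n
      _ = _ := tsum_mul_right
  let x : Op := Op.mk
    { toFun := X
      map_add' := fun η η' => RapidSeq.ext fun j => by
        refine (hX' (η + η') j).unique (((hX' η j).add (hX' η' j)).congr_fun fun n => ?_)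
        rw [pair_add]; ring
      map_smul' := fun c η => RapidSeq.ext fun j => by
        refine (hX' (c • η) j).unique (((hX' η j).mul_left c).congr_fun fun n => ?_)
        rw [pair_smul]; ring }
    fun q r => by
      obtain ⟨C, hC⟩ := hbound q r
      -- For N = 0 the partial sum is empty and the factor is 1, so the rate estimate is also the
      -- continuity estimate.
      exact ⟨C, fun η hη => by simpa using hC 0 η hη⟩
  refine ⟨x, Op.tendsto_of_bound fun q r => ?_, hX'⟩
  obtain ⟨C, hC⟩ := hbound q r
  refine ⟨C, fun N η hη => le_of_eq_of_le ?_ (hC N η hη)⟩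
  have e : (∑ n ∈ Finset.range N, μ n • rankOne (f n) (f n) - x) η
      = ∑ n ∈ Finset.range N, (μ n * pair η (f n)) • f n - X η := by
    have : (∑ n ∈ Finset.range N, μ n • rankOne (f n) (f n) - x) η
      = (∑ n ∈ Finset.range N, μ n • rankOne (f n) (f n)) η - X η := rfl
    rw [this, Op.sum_apply]
    congr 1
    refine Finset.sum_congr rfl fun n _ => ?_
    rw [mul_smul]
    rfl
  rw [e, ← RapidSeq.norms_apply, map_sub_rev, RapidSeq.norms_apply]

/-! ### The algebra generated by orthogonal rank one projections -/

theorem Op.continuous_mul_left (z : Op) : Continuous fun x : Op => z * x :=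
  (ContinuousLinearMap.postcomp SlowSeq (z.comp incl)).continuous

theorem Op.continuous_mul_right (z : Op) : Continuous fun x : Op => x * z :=
  (ContinuousLinearMap.precomp RapidSeq (incl.comp z)).continuous

instance : T2Space RapidSeq := by
  have : T1Space RapidSeq := RapidSeq.withSeminorms.T1_of_separating fun ξ hξ => by
    by_contra! hcon
    refine hξ (RapidSeq.ext fun j => norm_le_zero_iff.1 ?_)
    exact (ξ.norm_apply_le 0 j).trans_eq (hcon 0)
  infer_instance

/-- Each commutation relation is a closed condition because the product is separately continuous and
the space is Hausdorff. -/
theorem Op.isClosed_centralizer (S : Set Op) :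
    IsClosed (NonUnitalStarSubalgebra.centralizer ℂ S : Set Op) := by
  rw [NonUnitalStarSubalgebra.coe_centralizer, Set.centralizer, Set.ofPred_forall]
  refine isClosed_iInter fun z => ?_
  rw [Set.ofPred_forall]
  exact isClosed_iInter fun _ => isClosed_eq (Op.continuous_mul_left z) (Op.continuous_mul_right z)

theorem isClosed_alg (Z : Set Op) : IsClosed (alg Z : Set Op) := by
  rw [alg, NonUnitalStarAlgebra.coe_sInf]
  exact isClosed_biInter fun E hE => hE.1

theorem subset_alg (Z : Set Op) : Z ⊆ alg Z := by
  rw [alg, NonUnitalStarAlgebra.coe_sInf]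
  exact Set.subset_iInter₂ fun E hE => hE.2

theorem alg_le {Z : Set Op} {E : NonUnitalStarSubalgebra ℂ Op} (hE : IsClosed (E : Set Op))
    (hZ : Z ⊆ E) : alg Z ≤ E := sInf_le ⟨hE, hZ⟩

/-- Double centralizer argument: the centralizer of Z is closed and contains Z, hence `alg Z`; so Z
lies in the centralizer of `alg Z`, which is closed as well and thus contains `alg Z`. -/
theorem alg_commute {Z : Set Op} (hstar : ∀ z ∈ Z, star z = z)
    (hcomm : ∀ z ∈ Z, ∀ w ∈ Z, z * w = w * z) :
    ∀ x ∈ alg Z, ∀ y ∈ alg Z, x * y = y * x := by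
  have h1 : alg Z ≤ NonUnitalStarSubalgebra.centralizer ℂ Z := by
    refine alg_le (Op.isClosed_centralizer Z) fun z hz => ?_
    rw [SetLike.mem_coe, NonUnitalStarSubalgebra.mem_centralizer_iff]
    intro w hw
    rw [hstar w hw]
    exact ⟨hcomm w hw z hz, hcomm w hw z hz⟩
  have h2 : alg Z ≤ NonUnitalStarSubalgebra.centralizer ℂ (alg Z : Set Op) := by
    refine alg_le (Op.isClosed_centralizer _) fun z hz => ?_
    rw [SetLike.mem_coe, NonUnitalStarSubalgebra.mem_centralizer_iff]
    intro x hx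
    have key : ∀ x ∈ alg Z, x * z = z * x := fun x hx =>
      ((NonUnitalStarSubalgebra.mem_centralizer_iff ℂ).1 (h1 hx) z hz).1.symm
    exact ⟨key x hx, key _ (star_mem hx)⟩
  intro x hx y hy
  exact ((NonUnitalStarSubalgebra.mem_centralizer_iff ℂ).1 (h2 hy) x hx).1

theorem rankOne_mul_rankOne (f g : RapidSeq) :
    rankOne f f * rankOne g g = pair g f • rankOne g f := by
  refine ContinuousLinearMap.ext fun η => ?_
  have h : (rankOne f f * rankOne g g) η = pair ⇑(pair η g • incl g) f • f := rfl
  have h' : (pair g f • rankOne g f) η = pair g f • pair η g • f := rfl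
  rw [h, h', pair_smul, smul_smul, mul_comm]
  rfl

theorem star_rankOne (f : RapidSeq) : star (rankOne f f) = rankOne f f :=
  Op.ext' fun η j => by
    have h : star (rankOne f f) η j = pair η ⇑(pair (SlowSeq.unit j) f • f) := rfl
    have h1 : pair (SlowSeq.unit j) f = conj (f j) := by
      rw [← pair_conj]; exact congrArg conj (pair_single f j)
    have h' : rankOne f f η j = pair η f * f j := rfl
    rw [h, h', h1, RapidSeq.coe_smul, pair, pair, ← tsum_mul_right]
    refine tsum_congr fun i => ?_
    simp only [Pi.smul_apply, smul_eq_mul, map_mul, Complex.conj_conj]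
    ring

section Orthonormal

variable {f : ℕ → RapidSeq} (hf : ∀ k l, pair (f k) (f l) = if k = l then 1 else 0)

include hf

theorem rankOne_mul_self (k : ℕ) :
    rankOne (f k) (f k) * rankOne (f k) (f k) = rankOne (f k) (f k) := by
  rw [rankOne_mul_rankOne, hf, if_pos rfl, one_smul]

theorem rankOne_mul_of_ne {k l : ℕ} (h : k ≠ l) :
    rankOne (f k) (f k) * rankOne (f l) (f l) = 0 := by
  rw [rankOne_mul_rankOne, hf, if_neg h.symm, zero_smul]

theorem rankOne_apply_self (k : ℕ) : rankOne (f k) (f k) (incl (f k)) = f k := by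
  have h : rankOne (f k) (f k) (incl (f k)) = pair (f k) (f k) • f k := rfl
  rw [h, hf, if_pos rfl, one_smul]

theorem wnorm_zero_eq_one (k : ℕ) : wnorm 0 (f k) = 1 := by
  have h : pair (f k) (f k) = ((∑' j : ℕ+, ‖f k j‖ ^ 2 * (j : ℝ) ^ (2 * (0 : ℤ)) : ℝ) : ℂ) := by
    rw [pair, Complex.ofReal_tsum]
    refine tsum_congr fun j => ?_
    rw [Complex.mul_conj, Complex.normSq_eq_norm_sq]
    simp
  rw [hf, if_pos rfl] at h
  rw [wnorm, Complex.ofReal_injective (h.symm.trans Complex.ofReal_one.symm), Real.sqrt_one]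

theorem alg_rankOne_commute :
    ∀ x ∈ alg (Set.range fun k => rankOne (f k) (f k)),
      ∀ y ∈ alg (Set.range fun k => rankOne (f k) (f k)), x * y = y * x := by
  refine alg_commute ?_ ?_
  · rintro _ ⟨k, rfl⟩
    exact star_rankOne _
  · rintro _ ⟨k, rfl⟩ _ ⟨l, rfl⟩
    rcases eq_or_ne k l with rfl | h
    · rfl
    · exact (rankOne_mul_of_ne hf h).trans (rankOne_mul_of_ne hf h.symm).symm

/-- The hypothesis gives x f_k = c f_k. Since the f_k are unit vectors of ℓ₂, the continuity of x
from the step ℓ₂ to |·|_q bounds all of these vectors at once. -/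
theorem eigenvalue_bound (x : Op) (q : ℕ) : ∃ C : ℝ, ∀ (k : ℕ) (c : ℂ),
    x * rankOne (f k) (f k) = c • rankOne (f k) (f k) → ‖c‖ * wnorm q (f k) ≤ C := by
  obtain ⟨C, hC⟩ := x.bound q 0
  refine ⟨C, fun k c h => ?_⟩
  have h1 := DFunLike.congr_fun h (incl (f k))
  rw [Op.mul_apply, rankOne_apply_self hf, _root_.smul_apply, rankOne_apply_self hf] at h1
  have h2 := hC (incl (f k)) ((f k).wsum_neg 0)
  rw [h1, RapidSeq.coe_smul, wnorm_smul] at h2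
  have h3 : wnorm (-((0 : ℕ) : ℤ)) (incl (f k)) = 1 := by
    simp only [Nat.cast_zero, neg_zero]
    exact wnorm_zero_eq_one hf k
  rwa [h3, mul_one] at h2

/-- Diagonal operators with sufficiently small eigenvalues belong to the generated algebra. -/
theorem exists_mem_alg_diagonal {φ : ℕ → ℕ} (hφ : Function.Injective φ) (μ : ℕ → ℂ)
    (h : ∀ q : ℕ, Summable fun n : ℕ => ((n : ℝ) + 1) * (‖μ n‖ * wnorm q (f (φ n)) ^ 2)) :
    ∃ x ∈ alg (Set.range fun k => rankOne (f k) (f k)),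
      ∀ n, x * rankOne (f (φ n)) (f (φ n)) = μ n • rankOne (f (φ n)) (f (φ n)) := by
  obtain ⟨x, hx, hxs⟩ := Op.exists_tendsto_diagonal (fun n => f (φ n)) μ h
  refine ⟨x, ?_, fun n => ?_⟩
  · refine (isClosed_alg _).mem_of_tendsto hx (Eventually.of_forall fun N => ?_)
    exact sum_mem fun n _ => SMulMemClass.smul_mem _ (subset_alg _ ⟨φ n, rfl⟩)
  · have h1 : x (incl (f (φ n))) = μ n • f (φ n) := RapidSeq.ext fun j => by
      refine (hxs (incl (f (φ n))) j).unique ?_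
      have e : ∀ m, pair (incl (f (φ n))) (f (φ m)) = if n = m then 1 else 0 := fun m => by
        rw [show pair (incl (f (φ n))) (f (φ m)) = pair (f (φ n)) (f (φ m)) from rfl, hf]
        simp only [hφ.eq_iff]
      have := hasSum_single (f := fun m => μ m * pair (incl (f (φ n))) (f (φ m)) * f (φ m) j) n
        fun m hm => by rw [e, if_neg hm.symm]; simp
      rw [e, if_pos rfl, mul_one] at this
      exact this
    refine ContinuousLinearMap.ext fun η => ?_
    have h3 : (x * rankOne (f (φ n)) (f (φ n))) η = x (pair η (f (φ n)) • incl (f (φ n))) := rfl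
    have h4 : (μ n • rankOne (f (φ n)) (f (φ n))) η = μ n • pair η (f (φ n)) • f (φ n) := rfl
    rw [h3, h4, map_smul, h1, smul_comm]

end Orthonormal

/-! ### The vectors of the example -/

theorem tower_succ (k j : ℕ) : (tower k (j + 1) : ℕ) = Nat.nth Nat.Prime k ^ (tower k j : ℕ) :=
  PNat.pow_coe _ _

theorem exists_tower_eq_pow (k j : ℕ) :
    ∃ e, e ≠ 0 ∧ (tower k j : ℕ) = Nat.nth Nat.Prime k ^ e := by
  cases j with
  | zero => exact ⟨1, one_ne_zero, by simp [tower]⟩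
  | succ j => exact ⟨tower k j, (tower k j).ne_zero, tower_succ k j⟩

/-- The entries of different towers are positive powers of different primes. This makes the supports
of the f_k disjoint. -/
theorem tower_ne_of_ne {k l : ℕ} (h : k ≠ l) (i j : ℕ) : tower k i ≠ tower l j := by
  intro heq
  obtain ⟨d, hd, hd'⟩ := exists_tower_eq_pow k i
  obtain ⟨e, -, he'⟩ := exists_tower_eq_pow l j
  have hdvd : Nat.nth Nat.Prime k ∣ Nat.nth Nat.Prime l ^ e := by
    rw [← he', ← heq, hd']
    exact dvd_pow_self _ hd
  have hk := Nat.prime_nth_prime k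
  have hl := Nat.prime_nth_prime l
  exact h (Nat.nth_injective Nat.infinite_setOfPred_prime
    ((Nat.prime_dvd_prime_iff_eq hk hl).1 (hk.dvd_of_dvd_pow hdvd)))

/-- Doubling is all that the geometric decay of the coefficients needs; the exponential growth
enters only in `eventually_pow_wnorm_le`. -/
theorem two_mul_tower_le_succ (k j : ℕ) : 2 * (tower k j : ℕ) ≤ tower k (j + 1) := by
  rw [tower_succ]
  refine le_trans ?_ (Nat.pow_le_pow_left (Nat.prime_nth_prime k).two_le _)
  obtain ⟨n, hn⟩ := Nat.exists_eq_succ_of_ne_zero (tower k j).ne_zero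
  rw [hn, pow_succ']
  exact Nat.mul_le_mul_left 2 Nat.lt_two_pow_self

theorem tower_strictMono (k : ℕ) : StrictMono fun j => (tower k j : ℕ) :=
  strictMono_nat_of_lt_succ fun j => by
    have := two_mul_tower_le_succ k j
    have := (tower k j).pos
    omega

theorem tower_injective (k : ℕ) : Function.Injective (tower k) := fun _ _ h =>
  (tower_strictMono k).injective (congrArg PNat.val h)

theorem tower_mono (k : ℕ) {i j : ℕ} (h : i ≤ j) : (tower k i : ℝ) ≤ tower k j := by
  exact_mod_cast (tower_strictMono k).monotone h

theorem two_mul_tower_le (k : ℕ) {i j : ℕ} (h : i < j) : 2 * (tower k i : ℝ) ≤ tower k j := by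
  refine le_trans ?_ (tower_mono k (Nat.succ_le_of_lt h))
  exact_mod_cast two_mul_tower_le_succ k i

theorem lt_tower (k j : ℕ) : k + 1 < tower k j := by
  have h1 : Nat.nth Nat.Prime k ≤ tower k j := by
    refine le_trans (le_of_eq ?_) ((tower_strictMono k).monotone (Nat.zero_le j))
    simp [tower]
  exact lt_of_lt_of_le (Nat.add_two_le_nth_prime k) h1

/-- The product of the first `q` entries of a tower. -/
noncomputable def towerProd (k q : ℕ) : ℝ := ∏ i ∈ Finset.range q, (tower k i : ℝ)

theorem towerProd_pos (k q : ℕ) : 0 < towerProd k q := Finset.prod_pos fun _ _ => pnat_pos _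

theorem towerProd_mul_pow_le (k j d : ℕ) :
    towerProd k j * (tower k j : ℝ) ^ d ≤ towerProd k (j + d) := by
  rw [towerProd, towerProd, Finset.prod_range_add]
  gcongr
  calc (tower k j : ℝ) ^ d = ∏ _i ∈ Finset.range d, (tower k j : ℝ) := by simp
    _ ≤ _ := Finset.prod_le_prod (fun i _ => (pnat_pos _).le) fun i _ =>
      tower_mono k (Nat.le_add_right j i)

theorem towerProd_add_le (k q d : ℕ) :
    towerProd k (q + d) ≤ towerProd k q * ((tower k (q + d) : ℝ) / 2) ^ d := by
  rw [towerProd, towerProd, Finset.prod_range_add]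
  gcongr
  calc ∏ i ∈ Finset.range d, (tower k (q + i) : ℝ)
      ≤ ∏ _i ∈ Finset.range d, ((tower k (q + d) : ℝ) / 2) :=
        Finset.prod_le_prod (fun i _ => (pnat_pos _).le) fun i hi => by
          have := two_mul_tower_le k (Nat.add_lt_add_left (Finset.mem_range.1 hi) q)
          linarith
    _ = _ := by rw [Finset.prod_const, Finset.card_range]

theorem towerProd_succ_le_pow (k q : ℕ) : towerProd k (q + 1) ≤ (tower k q : ℝ) ^ (q + 1) := by
  calc towerProd k (q + 1) ≤ ∏ _i ∈ Finset.range (q + 1), (tower k q : ℝ) :=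
        Finset.prod_le_prod (fun i _ => (pnat_pos _).le) fun i hi =>
          tower_mono k (Nat.lt_succ_iff.1 (Finset.mem_range.1 hi))
    _ = _ := by simp

/-! ### Size of the coefficients and normalization -/

theorem rawCoeff_pos (k j : ℕ) : 0 < rawCoeff k j :=
  div_pos (towerProd_pos k j) (pow_pos (pnat_pos _) _)

theorem rawCoeff_mul_pow_self (k q : ℕ) : rawCoeff k q * (tower k q : ℝ) ^ q = towerProd k q :=
  div_mul_cancel₀ _ (pow_pos (pnat_pos _) _).ne'

/-- The left side peaks at j = q, with value `towerProd k q`. For j = q + d, the d entries N_{k,q},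
…, N_{k,j-1} are each at most N_{k,j}/2, which gives the decay 2^{-d}. For q = j + d, the d surplus
factors N_{k,j} are replaced by the larger entries N_{k,j}, …, N_{k,q-1}, and 2^{q-j} ≥ 1 is
harmless. -/
theorem rawCoeff_mul_pow_le (k q j : ℕ) :
    rawCoeff k j * (tower k j : ℝ) ^ q ≤ towerProd k q * 2 ^ q * (1 / 2) ^ j := by
  have hT := towerProd_pos k q
  rcases le_total j q with h | h
  · obtain ⟨d, rfl⟩ := Nat.exists_eq_add_of_le h
    rw [pow_add, ← mul_assoc, rawCoeff_mul_pow_self]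
    refine (towerProd_mul_pow_le k j d).trans ?_
    rw [mul_assoc]
    refine le_mul_of_one_le_right hT.le ?_
    rw [pow_add, mul_right_comm, ← mul_pow]
    norm_num
    exact one_le_pow₀ one_le_two
  · obtain ⟨d, rfl⟩ := Nat.exists_eq_add_of_le h
    have hN := pnat_pos (tower k (q + d))
    refine le_of_mul_le_mul_right ?_ (pow_pos hN d)
    rw [mul_assoc, ← pow_add, rawCoeff_mul_pow_self]
    refine (towerProd_add_le k q d).trans (le_of_eq ?_)
    have : (2 : ℝ) ^ q * (1 / 2) ^ (q + d) = (1 / 2) ^ d := by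
      rw [pow_add, ← mul_assoc, ← mul_pow]; norm_num
    rw [mul_assoc (towerProd k q), this, mul_assoc, ← mul_pow, one_div_mul_eq_div]

theorem rawCoeff_le (k j : ℕ) : rawCoeff k j ≤ (1 / 2) ^ j := by
  simpa [towerProd] using rawCoeff_mul_pow_le k 0 j

theorem rawCoeff_sq_le (k j : ℕ) : rawCoeff k j ^ 2 ≤ (1 / 2) ^ j := by
  have h := rawCoeff_le k j
  have h1 : rawCoeff k j ≤ 1 := h.trans (pow_le_one₀ (by norm_num) (by norm_num))
  have h0 := rawCoeff_pos k j
  nlinarith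

theorem summable_rawCoeff_sq (k : ℕ) : Summable fun j => rawCoeff k j ^ 2 :=
  Summable.of_nonneg_of_le (fun _ => sq_nonneg _) (rawCoeff_sq_le k) summable_geometric_two

/-- The term with j = 0 equals 1. Together with the upper bound 2, this makes the normalization
change the coefficients by a bounded factor only. -/
theorem one_le_tsum_rawCoeff_sq (k : ℕ) : 1 ≤ ∑' j, rawCoeff k j ^ 2 := by
  have := (summable_rawCoeff_sq k).le_tsum 0 fun _ _ => sq_nonneg _
  simpa [rawCoeff] using this

theorem tsum_rawCoeff_sq_le (k : ℕ) : ∑' j, rawCoeff k j ^ 2 ≤ 2 :=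
  (Summable.tsum_le_tsum (rawCoeff_sq_le k) (summable_rawCoeff_sq k)
    summable_geometric_two).trans_eq tsum_geometric_two

theorem coeff_le_rawCoeff (k j : ℕ) : coeff k j ≤ rawCoeff k j :=
  mul_le_of_le_one_left (rawCoeff_pos k j).le
    (inv_le_one_of_one_le₀ (Real.one_le_sqrt.2 (one_le_tsum_rawCoeff_sq k)))

theorem rawCoeff_le_coeff (k j : ℕ) : rawCoeff k j / 2 ≤ coeff k j := by
  rw [coeff, div_eq_inv_mul]
  have h1 := one_le_tsum_rawCoeff_sq k
  have h2 : √(∑' i, rawCoeff k i ^ 2) ≤ 2 :=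
    Real.sqrt_le_iff.2 ⟨by norm_num, by linarith [tsum_rawCoeff_sq_le k]⟩
  have h3 : 0 < √(∑' i, rawCoeff k i ^ 2) := Real.sqrt_pos.2 (by linarith)
  have := (rawCoeff_pos k j).le
  gcongr

theorem coeff_nonneg (k j : ℕ) : 0 ≤ coeff k j :=
  (div_pos (rawCoeff_pos k j) two_pos).le.trans (rawCoeff_le_coeff k j)

theorem tsum_coeff_sq (k : ℕ) : ∑' j, coeff k j ^ 2 = 1 := by
  have h1 := one_le_tsum_rawCoeff_sq k
  simp only [coeff, mul_pow]
  rw [tsum_mul_left, inv_pow, Real.sq_sqrt (by linarith), inv_mul_cancel₀ (by linarith)]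

theorem wnorm_coeff_smul_unit (k q j : ℕ) :
    wnorm q ⇑((coeff k j : ℂ) • RapidSeq.unit (tower k j)) = coeff k j * (tower k j : ℝ) ^ q := by
  have h : wnorm q (RapidSeq.unit (tower k j)) = (tower k j : ℝ) ^ q := by
    rw [← zpow_natCast]; exact wnorm_single q (tower k j)
  rw [RapidSeq.coe_smul, wnorm_smul, h, Complex.norm_real, Real.norm_of_nonneg (coeff_nonneg k j)]

theorem coeff_mul_pow_le (k q j : ℕ) :
    coeff k j * (tower k j : ℝ) ^ q ≤ towerProd k q * 2 ^ q * (1 / 2) ^ j :=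
  (mul_le_mul_of_nonneg_right (coeff_le_rawCoeff k j) (pow_nonneg (pnat_pos _).le _)).trans
    (rawCoeff_mul_pow_le k q j)

/-- The vectors `f_k`, with two-sided estimates of their norms. -/
theorem exists_towerVector (k : ℕ) : ∃ f : RapidSeq,
    HasSum (fun j : ℕ => (coeff k j : ℂ) • RapidSeq.unit (tower k j)) f ∧
    (∀ j, f (tower k j) = coeff k j) ∧ (∀ i, i ∉ Set.range (tower k) → f i = 0) ∧
    (∀ q : ℕ, towerProd k q / 2 ≤ wnorm q f) ∧
    ∀ q : ℕ, wnorm q f ≤ 2 ^ (q + 1) * towerProd k q := by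
  have hs : ∀ q : ℕ, Summable fun j : ℕ =>
      wnorm q ⇑((coeff k j : ℂ) • RapidSeq.unit (tower k j)) := fun q => by
    simp only [wnorm_coeff_smul_unit]
    exact Summable.of_nonneg_of_le
      (fun j => mul_nonneg (coeff_nonneg k j) (pow_nonneg (pnat_pos _).le _))
      (coeff_mul_pow_le k q) (summable_geometric_two.mul_left _)
  obtain ⟨f, h1, h2, h3⟩ := RapidSeq.exists_hasSum _ hs
  have hunit : ∀ i j, ((coeff k j : ℂ) • RapidSeq.unit (tower k j)) i
      = (coeff k j : ℂ) * (Pi.single (tower k j) 1 : ℕ+ → ℂ) i := fun i j => rfl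
  have hval : ∀ j, f (tower k j) = coeff k j := fun j => by
    refine (h2 (tower k j)).unique ?_
    have := hasSum_single (f := fun i => ((coeff k i : ℂ) • RapidSeq.unit (tower k i)) (tower k j))
      j fun i hi => by
        rw [hunit, Pi.single_eq_of_ne ((tower_injective k).ne hi.symm), mul_zero]
    rwa [hunit, Pi.single_eq_same, mul_one] at this
  refine ⟨f, h1, hval, fun i hi => ?_, fun q => ?_, fun q => ?_⟩
  · refine (h2 i).unique ?_
    refine hasSum_zero.congr_fun fun j => ?_
    rw [hunit, Pi.single_eq_of_ne (fun h => hi ⟨j, h.symm⟩), mul_zero]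
  -- The single coordinate N_{k,q}, where the weighted coefficients peak, already gives the lower
  -- bound.
  · have h4 := f.norm_mul_pow_le q (tower k q)
    rw [hval, Complex.norm_real, Real.norm_of_nonneg (coeff_nonneg k q)] at h4
    refine le_trans ?_ h4
    rw [← rawCoeff_mul_pow_self, mul_div_right_comm]
    exact mul_le_mul_of_nonneg_right (rawCoeff_le_coeff k q) (pow_nonneg (pnat_pos _).le _)
  · refine (h3 q).trans ?_
    have hle : ∀ j, wnorm q ⇑((coeff k j : ℂ) • RapidSeq.unit (tower k j))
        ≤ towerProd k q * 2 ^ q * (1 / 2) ^ j := fun j => by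
      rw [wnorm_coeff_smul_unit]
      exact coeff_mul_pow_le k q j
    refine (Summable.tsum_le_tsum hle (hs q) (summable_geometric_two.mul_left _)).trans_eq ?_
    rw [tsum_mul_left, tsum_geometric_two]
    ring

theorem pair_towerVector {f : ℕ → RapidSeq} (h1 : ∀ k j, f k (tower k j) = coeff k j)
    (h2 : ∀ k i, i ∉ Set.range (tower k) → f k i = 0) (k l : ℕ) :
    pair (f k) (f l) = if k = l then 1 else 0 := by
  split_ifs with h
  · subst h
    rw [pair, ← (tower_injective k).tsum_eq]
    · rw [← Complex.ofReal_one, ← tsum_coeff_sq k, Complex.ofReal_tsum]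
      refine tsum_congr fun j => ?_
      rw [h1, Complex.conj_ofReal, Complex.ofReal_pow, sq]
    · intro i hi
      by_contra hcon
      exact hi (by simp [h2 k i hcon])
  · rw [pair]
    refine (tsum_congr fun i => ?_).trans tsum_zero
    by_cases hi : i ∈ Set.range (tower k)
    · obtain ⟨j, rfl⟩ := hi
      rw [h2 l _ (by rintro ⟨m, hm⟩; exact tower_ne_of_ne h j m hm.symm), map_zero, mul_zero]
    · rw [h2 k i hi, zero_mul]

/-- Each norm of `f_k` grows faster in `k` than all powers of the preceding one. -/
theorem eventually_pow_wnorm_le {f : ℕ → RapidSeq}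
    (hlow : ∀ k (q : ℕ), towerProd k q / 2 ≤ wnorm q (f k))
    (hup : ∀ k (q : ℕ), wnorm q (f k) ≤ 2 ^ (q + 1) * towerProd k q) (p r : ℕ) (C : ℝ) :
    ∀ᶠ k : ℕ in atTop,
      C * wnorm (p + 1 : ℕ) (f k) ^ r * ((k : ℝ) + 1) ^ 3 ≤ wnorm (p + 2 : ℕ) (f k) := by
  -- The indices start at p + 1 because the gap from |f_k|_0 = 1 to |f_k|_1 is only of the order of
  -- the k-th prime. From p + 1 to p + 2 it is exponential: with t = N_{k,p} the former norm is at
  -- most a constant times t^{p+1}, the latter at least 2^t/2.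
  have hlim : Tendsto (fun k : ℕ => (tower k p : ℕ)) atTop atTop :=
    tendsto_atTop_mono (fun k => ((Nat.le_succ k).trans (lt_tower k p).le)) tendsto_id
  have hgrow := (tendsto_pow_const_div_const_pow_of_one_lt ((p + 1) * r + 3)
    (one_lt_two : (1 : ℝ) < 2)).comp hlim
  have hev := hgrow.eventually_lt_const
    -- The 2 pays for the halved lower bound of the norm; the + 1 keeps the threshold positive when
    -- C = 0.
    (show (0 : ℝ) < (2 * (|C| * (2 ^ (p + 2)) ^ r + 1))⁻¹ by positivity)
  filter_upwards [hev] with k hk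
  simp only [Function.comp_apply] at hk
  set t : ℝ := (tower k p : ℝ) with ht
  have ht1 : 1 ≤ t := one_le_pnat _
  have hk1 : (k : ℝ) + 1 ≤ t := by
    rw [ht]; exact_mod_cast (lt_tower k p).le
  have hT : towerProd k (p + 1) ≤ t ^ (p + 1) := towerProd_succ_le_pow k p
  have hN : (2 : ℝ) ^ (tower k p : ℕ) ≤ towerProd k (p + 2) := by
    have h1 : (2 : ℝ) ^ (tower k p : ℕ) ≤ tower k (p + 1) := by
      have := Nat.pow_le_pow_left (Nat.prime_nth_prime k).two_le (tower k p : ℕ)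
      rw [← tower_succ] at this
      exact_mod_cast this
    have h2 : towerProd k (p + 2) = towerProd k (p + 1) * tower k (p + 1) :=
      Finset.prod_range_succ _ _
    have h3 : 1 ≤ towerProd k (p + 1) := by
      have := towerProd_mul_pow_le k 0 (p + 1)
      rw [zero_add] at this
      refine le_trans ?_ this
      simp only [towerProd, Finset.range_zero, Finset.prod_empty, one_mul]
      exact one_le_pow₀ (one_le_pnat _)
    rw [h2]
    exact h1.trans (le_mul_of_one_le_left (pnat_pos _).le h3)
  have hw : wnorm (p + 1 : ℕ) (f k) ≤ 2 ^ (p + 2) * t ^ (p + 1) :=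
    (hup k (p + 1)).trans (by gcongr)
  have hw0 := wnorm_nonneg (p + 1 : ℕ) (f k)
  have hlow' := hlow k (p + 2)
  rw [div_lt_iff₀ (by positivity), inv_mul_eq_div, lt_div_iff₀ (by positivity)] at hk
  calc C * wnorm (p + 1 : ℕ) (f k) ^ r * ((k : ℝ) + 1) ^ 3
      ≤ |C| * (2 ^ (p + 2) * t ^ (p + 1)) ^ r * t ^ 3 := by
        gcongr
        exact le_abs_self C
    _ = t ^ ((p + 1) * r + 3) * (|C| * (2 ^ (p + 2)) ^ r) := by
        rw [mul_pow, pow_add t ((p + 1) * r), pow_mul t]; ring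
    _ ≤ t ^ ((p + 1) * r + 3) * (|C| * (2 ^ (p + 2)) ^ r + 1) := by gcongr; linarith
    _ ≤ towerProd k (p + 2) / 2 := by linarith
    _ ≤ _ := hlow'

/-! ### Comparison with subalgebras of `s` -/

/-- Idempotents of `s` are indicator functions of finite sets. -/
theorem RapidSeq.exists_max_of_idempotent {e : RapidSeq} (he : e * e = e) (h0 : e ≠ 0) :
    ∃ m : ℕ+, e m = 1 ∧ (∀ j, m < j → e j = 0) ∧ ∀ j, ‖e j‖ ≤ 1 := by
  have h01 : ∀ j, e j = 0 ∨ e j = 1 := fun j => by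
    have : e j * e j = e j := DFunLike.congr_fun he j
    exact or_iff_not_imp_left.2 fun h => mul_left_cancel₀ h (this.trans (mul_one _).symm)
  have hfin : {j | e j = 1}.Finite := by
    refine (Set.finite_Iic (⌈wnorm 1 e⌉₊.succPNat)).subset fun j hj => ?_
    have h1 := e.norm_mul_pow_le 1 j
    rw [show e j = 1 from hj, norm_one, one_mul, pow_one] at h1
    have h2 : (j : ℕ) ≤ ⌈wnorm 1 e⌉₊ := by exact_mod_cast h1.trans (Nat.le_ceil _)
    rw [Set.mem_Iic, ← PNat.coe_le_coe, Nat.succPNat_coe]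
    exact h2.trans (Nat.le_succ _)
  have hne : {j | e j = 1}.Nonempty := by
    by_contra hcon
    rw [Set.not_nonempty_iff_eq_empty, Set.eq_empty_iff_forall_notMem] at hcon
    exact h0 (RapidSeq.ext fun j => (h01 j).resolve_right (hcon j))
  obtain ⟨m, hm, hmax⟩ := Set.exists_max_image _ id hfin hne
  refine ⟨m, hm, fun j hj => (h01 j).resolve_right fun h => ?_, fun j => ?_⟩
  · exact absurd (hmax j h) (not_le.2 hj)
  · rcases h01 j with h | h <;> simp [h]

/-- At most m coordinates contribute, each at most m^{2q}. The resulting m^{2q+1} is rounded up to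
m^{2q+2} so that the root is an integer power. -/
theorem wnorm_le_of_support_le {ξ : ℕ+ → ℂ} {m : ℕ+} (h0 : ∀ j, m < j → ξ j = 0)
    (h1 : ∀ j, ‖ξ j‖ ≤ 1) (q : ℕ) : wnorm q ξ ≤ (m : ℝ) ^ (q + 1) := by
  have hm := one_le_pnat m
  refine Real.sqrt_le_iff.2 ⟨by positivity, ?_⟩
  rw [tsum_eq_sum (s := Finset.Icc 1 m) fun j hj => by
    rw [h0 j (not_le.1 fun h => hj (Finset.mem_Icc.2 ⟨one_le, h⟩))]; simp]
  calc ∑ j ∈ Finset.Icc 1 m, ‖ξ j‖ ^ 2 * (j : ℝ) ^ (2 * (q : ℤ))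
      ≤ ∑ _j ∈ Finset.Icc 1 m, ((m : ℝ) ^ q) ^ 2 := by
        refine Finset.sum_le_sum fun j hj => ?_
        have hjm : (j : ℝ) ≤ m := by exact_mod_cast (Finset.mem_Icc.1 hj).2
        have hj0 := (pnat_pos j).le
        rw [wterm_eq, zpow_natCast]
        gcongr
        calc ‖ξ j‖ * (j : ℝ) ^ q ≤ 1 * (m : ℝ) ^ q := by gcongr; exact h1 j
          _ = _ := one_mul _
    _ = (m : ℝ) * ((m : ℝ) ^ q) ^ 2 := by simp
    _ ≤ (m : ℝ) ^ 2 * ((m : ℝ) ^ q) ^ 2 := by gcongr; exact le_self_pow₀ hm two_ne_zero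
    _ = _ := by ring

theorem summable_succ_div_two_pow : Summable fun n : ℕ => ((n : ℝ) + 1) * (1 / 2) ^ n := by
  have h1 := summable_pow_mul_geometric_of_norm_lt_one 1 (r := (1 / 2 : ℝ)) (by norm_num)
  refine (h1.add summable_geometric_two).congr fun n => ?_
  ring

section Iso

variable {f : ℕ → RapidSeq} (hf : ∀ k l, pair (f k) (f l) = if k = l then 1 else 0)
  {F : NonUnitalStarSubalgebra ℂ RapidSeq}
  {Φ : alg (Set.range fun k => rankOne (f k) (f k)) ≃ₗ[ℂ] F}
  (hΦ : ∀ x y, Φ (x * y) = Φ x * Φ y)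

/-- The projection `⟨·, f_k⟩ f_k` as an element of the generated algebra. -/
noncomputable def algProj (f : ℕ → RapidSeq) (k : ℕ) :
    alg (Set.range fun k => rankOne (f k) (f k)) :=
  ⟨rankOne (f k) (f k), subset_alg _ ⟨k, rfl⟩⟩

include hΦ

/-- Eigenvalues at f_k are encoded by multiplication with an idempotent, hence preserved and
reflected by any injective linear multiplicative map. -/
theorem map_mul_algProj_iff (x : alg (Set.range fun k => rankOne (f k) (f k))) (k : ℕ) (c : ℂ) :
    (Φ x : RapidSeq) * Φ (algProj f k) = c • (Φ (algProj f k) : RapidSeq) ↔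
      (x : Op) * rankOne (f k) (f k) = c • rankOne (f k) (f k) := by
  have h1 : (x : Op) * rankOne (f k) (f k) = c • rankOne (f k) (f k)
      ↔ x * algProj f k = c • algProj f k := by rw [Subtype.ext_iff]; rfl
  have h2 : (Φ x : RapidSeq) * Φ (algProj f k) = c • (Φ (algProj f k) : RapidSeq)
      ↔ Φ x * Φ (algProj f k) = c • Φ (algProj f k) := by rw [Subtype.ext_iff]; rfl
  rw [h1, h2, ← hΦ, ← map_smul, Φ.injective.eq_iff]

include hf

theorem map_algProj_mul_of_ne {k l : ℕ} (h : k ≠ l) :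
    (Φ (algProj f k) : RapidSeq) * Φ (algProj f l) = 0 := by
  have := (map_mul_algProj_iff hΦ (algProj f k) l 0).2
    (by rw [zero_smul]; exact rankOne_mul_of_ne hf h)
  rwa [zero_smul] at this

theorem exists_max_map_algProj (k : ℕ) : ∃ m : ℕ+, (Φ (algProj f k) : RapidSeq) m = 1 ∧
    (∀ j, m < j → (Φ (algProj f k) : RapidSeq) j = 0) ∧
    ∀ j, ‖(Φ (algProj f k) : RapidSeq) j‖ ≤ 1 := by
  refine RapidSeq.exists_max_of_idempotent ?_ fun h => ?_
  · have := (map_mul_algProj_iff hΦ (algProj f k) k 1).2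
      (by rw [one_smul]; exact rankOne_mul_self hf k)
    rwa [one_smul] at this
  -- The projection is nonzero because it fixes the unit vector f_k.
  · have h1 : Φ (algProj f k) = 0 := Subtype.ext h
    have h2 : rankOne (f k) (f k) = 0 :=
      congrArg Subtype.val ((map_eq_zero_iff Φ Φ.injective).1 h1)
    have h3 := rankOne_apply_self hf k
    rw [h2] at h3
    have h4 := hf k k
    rw [← h3, if_pos rfl] at h4
    have h5 : pair ⇑((0 : Op) (incl (f k))) ⇑((0 : Op) (incl (f k))) = 0 := by
      refine (tsum_congr fun j => ?_).trans tsum_zero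
      exact zero_mul _
    exact zero_ne_one (h5.symm.trans h4)

/-- The supports of the images of the projections are controlled by some norm of the `f_k`. -/
theorem exists_eventually_max_lt {m : ℕ → ℕ+}
    (hm : ∀ k, (Φ (algProj f k) : RapidSeq) (m k) = 1) :
    ∃ n : ℕ, ∀ᶠ k in atTop, (m k : ℝ) < 4 ^ n * wnorm n (f k) ^ 2 := by
  by_contra! hcon
  obtain ⟨φ, hφ, hφ'⟩ := extraction_forall_of_frequently hcon
  have hmpos : ∀ n, (0 : ℝ) < m (φ n) := fun n => pnat_pos _
  -- Along the extracted subsequence 4^n |f_{φ n}|_n² ≤ `m (φ n)`. The eigenvalues 2^n / `m (φ n)`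
  -- are then small enough for the diagonal series (for n ≥ q, multiplying by |f_{φ n}|_q² leaves at
  -- most 2^{-n}), yet they force |Φ x|_1 ≥ 2^n for all n.
  obtain ⟨x, hx, hxe⟩ := exists_mem_alg_diagonal hf hφ.injective
    (fun n => ((2 ^ n / (m (φ n) : ℝ) : ℝ) : ℂ)) fun q => by
      refine summable_succ_div_two_pow.of_norm_bounded_eventually_nat ?_
      filter_upwards [eventually_ge_atTop q] with n hn
      have h1 := (f (φ n)).wnorm_mono hn
      have h0 := wnorm_nonneg q (f (φ n))
      have h2 := hφ' n
      have h3 := hmpos n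
      rw [Complex.norm_real, Real.norm_of_nonneg (by positivity : (0 : ℝ) ≤ 2 ^ n / (m (φ n) : ℝ)),
        Real.norm_of_nonneg (by positivity)]
      gcongr
      rw [div_mul_eq_mul_div, div_le_iff₀ h3]
      calc (2 : ℝ) ^ n * wnorm q (f (φ n)) ^ 2 ≤ 2 ^ n * wnorm n (f (φ n)) ^ 2 := by gcongr
        _ = (1 / 2) ^ n * (4 ^ n * wnorm n (f (φ n)) ^ 2) := by
          rw [← mul_assoc, ← mul_pow]; norm_num
        _ ≤ (1 / 2) ^ n * (m (φ n) : ℝ) := by gcongr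
  have hval : ∀ n, (Φ ⟨x, hx⟩ : RapidSeq) (m (φ n)) = ((2 ^ n / (m (φ n) : ℝ) : ℝ) : ℂ) :=
    fun n => by
      have h1 := DFunLike.congr_fun
        ((map_mul_algProj_iff hΦ ⟨x, hx⟩ (φ n) _).2 (hxe n)) (m (φ n))
      rw [RapidSeq.coe_mul, RapidSeq.coe_smul, Pi.mul_apply, Pi.smul_apply, hm] at h1
      simpa using h1
  obtain ⟨n, hn⟩ := pow_unbounded_of_one_lt (wnorm (1 : ℕ) (Φ ⟨x, hx⟩ : RapidSeq))
    (one_lt_two : (1 : ℝ) < 2)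
  have h1 := (Φ ⟨x, hx⟩ : RapidSeq).norm_mul_pow_le 1 (m (φ n))
  have h3 := hmpos n
  rw [hval, Complex.norm_real, Real.norm_of_nonneg (by positivity), pow_one,
    div_mul_cancel₀ _ h3.ne'] at h1
  exact absurd h1 (not_le.2 hn)

/-- Norms as those of the vectors `f_k` rule out every isomorphism onto a closed subalgebra. -/
theorem false_of_isoAlg (hF : IsClosed (F : Set RapidSeq))
    (hlow : ∀ k (q : ℕ), towerProd k q / 2 ≤ wnorm q (f k))
    (hup : ∀ k (q : ℕ), wnorm q (f k) ≤ 2 ^ (q + 1) * towerProd k q) : False := by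
  choose m hm hm0 hm1 using exists_max_map_algProj hf hΦ
  obtain ⟨p, hp⟩ := exists_eventually_max_lt hf hΦ hm
  have hwpos : ∀ k (q : ℕ), 0 < wnorm q (f k) := fun k q =>
    (half_pos (towerProd_pos k q)).trans_le (hlow k q)
  -- The numerator makes `lam k` times |f_k|_{p+2} unbounded; the denominator outgrows every norm of
  -- the images of the projections.
  set lam : ℕ → ℝ := fun k => ((k : ℝ) + 1) / wnorm (p + 2 : ℕ) (f k) with hlam
  have hlam0 : ∀ k, 0 ≤ lam k := fun k => div_nonneg (by positivity) (hwpos k _).le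
  have hsum : ∀ q : ℕ, Summable fun k =>
      wnorm q ⇑((lam k : ℂ) • (Φ (algProj f k) : RapidSeq)) := fun q => by
    have hs : Summable fun k : ℕ => 1 / ((k : ℝ) + 1) ^ 2 := by
      have := (summable_nat_add_iff 1).2 (Real.summable_one_div_nat_pow.2 one_lt_two)
      simpa using this
    refine hs.of_norm_bounded_eventually_nat ?_
    -- The exponent 2(q+1) comes from (`m k`)^{q+1} with `m k` < 4^p |f_k|_p². Of the three factors
    -- k + 1, one is the numerator of `lam k` and two give the summable majorant 1/(k+1)².
    filter_upwards [hp, eventually_pow_wnorm_le hlow hup p (2 * (q + 1)) ((4 ^ p) ^ (q + 1))]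
      with k h1 h2
    have hw := wnorm_nonneg p (f k)
    have hk : (0 : ℝ) < (k : ℝ) + 1 := by positivity
    rw [Real.norm_of_nonneg (wnorm_nonneg _ _), RapidSeq.coe_smul, wnorm_smul, Complex.norm_real,
      Real.norm_of_nonneg (hlam0 k)]
    have h3 : wnorm q (Φ (algProj f k) : RapidSeq)
        ≤ (4 ^ p) ^ (q + 1) * wnorm (p + 1 : ℕ) (f k) ^ (2 * (q + 1)) :=
      calc wnorm q (Φ (algProj f k) : RapidSeq) ≤ (m k : ℝ) ^ (q + 1) :=
            wnorm_le_of_support_le (hm0 k) (hm1 k) q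
        _ ≤ (4 ^ p * wnorm (p + 1 : ℕ) (f k) ^ 2) ^ (q + 1) := by
            have h4 := (f k).wnorm_mono (Nat.le_succ p)
            refine pow_le_pow_left₀ (pnat_pos _).le (h1.le.trans ?_) _
            gcongr
        _ = _ := by rw [mul_pow, pow_mul]
    rw [hlam, div_mul_eq_mul_div, div_le_div_iff₀ (hwpos k _) (by positivity), one_mul]
    refine le_trans ?_ h2
    calc ((k : ℝ) + 1) * wnorm q (Φ (algProj f k) : RapidSeq) * ((k : ℝ) + 1) ^ 2
        = wnorm q (Φ (algProj f k) : RapidSeq) * ((k : ℝ) + 1) ^ 3 := by ring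
      _ ≤ _ := by gcongr
  obtain ⟨ξ, hξ, hξj, -⟩ := RapidSeq.exists_hasSum _ hsum
  have hξF : ξ ∈ F := hF.mem_of_tendsto hξ (Eventually.of_forall fun s =>
    sum_mem fun k _ => SMulMemClass.smul_mem _ (Φ (algProj f k)).2)
  have heig : ∀ k, ξ * Φ (algProj f k) = (lam k : ℂ) • (Φ (algProj f k) : RapidSeq) := fun k =>
    RapidSeq.ext fun j => by
      refine ((hξj j).mul_right ((Φ (algProj f k) : RapidSeq) j)).unique ?_
      -- The images of different projections have product zero, so only the term l = k survives.
      have hz : ∀ l, l ≠ k → ((lam l : ℂ) • (Φ (algProj f l) : RapidSeq)) j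
          * (Φ (algProj f k) : RapidSeq) j = 0 := fun l hl => by
        have := DFunLike.congr_fun (map_algProj_mul_of_ne hf hΦ hl) j
        rw [RapidSeq.coe_mul, Pi.mul_apply] at this
        rw [RapidSeq.coe_smul, Pi.smul_apply, smul_eq_mul, mul_assoc, this]
        exact mul_zero _
      have := hasSum_single (f := fun l => ((lam l : ℂ) • (Φ (algProj f l) : RapidSeq)) j
          * (Φ (algProj f k) : RapidSeq) j) k hz
      have hid := DFunLike.congr_fun ((map_mul_algProj_iff hΦ (algProj f k) k 1).2
        (by rw [one_smul]; exact rankOne_mul_self hf k)) j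
      rw [one_smul, RapidSeq.coe_mul, Pi.mul_apply] at hid
      rwa [RapidSeq.coe_smul, Pi.smul_apply, smul_eq_mul, mul_assoc, hid] at this
  -- Surjectivity of Φ is used here: the sum of the series has a preimage, whose eigenvalues at the
  -- f_k are the `lam k`.
  obtain ⟨C, hC⟩ := eigenvalue_bound hf (Φ.symm ⟨ξ, hξF⟩ : Op) (p + 2)
  obtain ⟨k, hk⟩ := exists_nat_gt C
  have h1 := hC k (lam k) ((map_mul_algProj_iff hΦ _ k _).1 (by
    rw [LinearEquiv.apply_symm_apply]; exact heig k))
  rw [Complex.norm_real, Real.norm_of_nonneg (hlam0 k), hlam,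
    div_mul_cancel₀ _ (hwpos k _).ne'] at h1
  linarith

end Iso

end SmoothOp

/-! ### The theorem -/

theorem mainTheorem2 :
    ∃ f : ℕ → RapidSeq,
      (∀ k, HasSum (fun j : ℕ => (coeff k j : ℂ) • RapidSeq.unit (tower k j)) (f k)) ∧
      (∀ k l, pair (f k) (f l) = if k = l then 1 else 0) ∧
      ∃ E : NonUnitalStarSubalgebra ℂ Op,
        E = alg (Set.range fun k => rankOne (f k) (f k)) ∧
        IsClosed (E : Set Op) ∧
        (∀ x ∈ E, ∀ y ∈ E, x * y = y * x) ∧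
        ∀ F : NonUnitalStarSubalgebra ℂ RapidSeq, IsClosed (F : Set RapidSeq) →
          ¬ IsoFrechetStarAlg E F ∧ ¬ IsoAlg E F := by
  choose f hsum hval hzero hlow hup using exists_towerVector
  have hf := pair_towerVector hval hzero
  refine ⟨f, hsum, hf, _, rfl, isClosed_alg _, alg_rankOne_commute hf, fun F hF => ⟨?_, ?_⟩⟩
  · rintro ⟨Φ, -, -⟩
    exact false_of_isoAlg (Φ := { Φ.toEquiv with map_add' := map_add Φ, map_smul' := map_smul Φ })
      hf (fun x y => map_mul Φ x y) hF hlow hup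
  · rintro ⟨Φ, hΦ⟩
    exact false_of_isoAlg hf hΦ hF hlow hup
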